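/- Let $0<\kappa<1$ and let $P_\kappa=\wp(\,\cdot\,;G_2,G_3)$ be the Weierstrass function with invariants $$G_2=48(1+8\kappa^2),\qquad G_3=64(1-20\kappa^2-8\kappa^4).$$ Then $P_\kappa$ has a rectangular period lattice: its periods are exactly the integer combinations of $2\Omega_\kappa$ and $2\Omega_\kappa'$ for a (unique) real $\Omega_\kappa>0$ and a purely imaginary $\Omega_\kappa'$ with positive imaginary part. Its real fundamental half-period is $$\Omega_\kappa=\frac{1}{2\sqrt6}\,\pi\;{}_2F_1\!\left(\tfrac13,\tfrac23;1;\kappa^2\right).$$ -/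

import Mathlib

noncomputable section

/-- `P` is the Weierstrass function `℘(•; g₂, g₃)` with invariants `g₂` and `g₃`: the Weierstrass
function of a lattice in `ℂ` whose invariants are `g₂ = 60 ∑ ℓ⁻⁴` and `g₃ = 140 ∑ ℓ⁻⁶`. -/
def IsWeierstrassP (g₂ g₃ : ℂ) (P : ℂ → ℂ) : Prop :=
  ∃ L : PeriodPair, L.g₂ = g₂ ∧ L.g₃ = g₃ ∧ P = L.weierstrassP

/-- `(2 * Ω, 2 * Ω')` is the fundamental pair of periods of a function `P` with a rectangular
period lattice: `Ω` is real and positive, `Ω'` is purely imaginary with positive imaginary part,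
and the periods of `P` are exactly the integer combinations of `2 * Ω` and `2 * Ω'`. -/
def IsRectangularHalfPeriodPair (P : ℂ → ℂ) (Ω Ω' : ℂ) : Prop :=
  (Ω.im = 0 ∧ 0 < Ω.re) ∧ (Ω'.re = 0 ∧ 0 < Ω'.im) ∧
    ∀ T : ℂ, Function.Periodic P T ↔ ∃ m n : ℤ, T = m * (2 * Ω) + n * (2 * Ω')

/-- `Ω` is the real fundamental half-period of `P`. -/
def IsRealFundamentalHalfPeriod (P : ℂ → ℂ) (Ω : ℝ) : Prop :=
  ∃ Ω' : ℂ, IsRectangularHalfPeriodPair P (Ω : ℂ) Ω'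

/-- `P` is the Weierstrass function `P_κ` attached to the modulus `κ`. -/
def IsPκ (κ : ℝ) (P : ℂ → ℂ) : Prop :=
  IsWeierstrassP (48 * (1 + 8 * (κ : ℂ) ^ 2))
    (64 * (1 - 20 * (κ : ℂ) ^ 2 - 8 * (κ : ℂ) ^ 4)) P

end

open Filter Topology
open scoped MatrixGroups

/-! The discriminant `G₂³ - 27 G₃²` is a positive multiple of `κ²(1 - κ²)³`. On the imaginary axis
`E₆ / E₄^(3/2)` takes every value in `(-1, 1)`, so some rectangular lattice, with real period `a`,
has these invariants (`exists_rectangular`). The equation `℘'² = 4℘³ - g₂℘ - g₃` determines the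
Laurent germ of `℘` at `0`, hence its poles: every `P_κ` has this same lattice
(`lattice_eq_of_invariants_eq`).

On `(0, a/2]` the function `℘` is real and decreases from `∞` to a root of the cubic, so `a/2 = ∫ dX
/ √(4X³ - G₂X - G₃)`. Put `sin φ = κ cos θ`, `y = sin (φ/3)`, `X = cubicValue κ y`. The identity
`cubicValueDeriv_sq_mul`, with `3y - 4y³ = κ cos θ`, removes the square root, and `cos (φ/3) / cos φ
= ₂F₁(1/3, 2/3; 1/2; sin² φ)` (`trigSeries_sin_sq`) turns the integral into `(1/√6) ∫ ₂F₁(1/3, 2/3;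
1/2; κ² cos² θ) dθ` over `[0, π/2]`. Integrating termwise, Wallis' formula changes the lower
parameter `1/2` into `1` (`integral_trigSeries`). -/

/-! ### Uniqueness for analytic germs -/

/-- Two germs `z⁻² + p z` and `z⁻² + q z` which satisfy the same equation
`f' ^ 2 = 4 * f ^ 3 - a * f - b` (cleared of denominators) coincide. -/
theorem eventuallyEq_of_weierstrass_equation {p q : ℂ → ℂ} {a b : ℂ}
    (hp : AnalyticAt ℂ p 0) (hq : AnalyticAt ℂ q 0)
    (hpe : ∀ᶠ z in 𝓝[≠] 0, (-2 + z ^ 3 * deriv p z) ^ 2 =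
      4 * (1 + z ^ 2 * p z) ^ 3 - a * z ^ 4 * (1 + z ^ 2 * p z) - b * z ^ 6)
    (hqe : ∀ᶠ z in 𝓝[≠] 0, (-2 + z ^ 3 * deriv q z) ^ 2 =
      4 * (1 + z ^ 2 * q z) ^ 3 - a * z ^ 4 * (1 + z ^ 2 * q z) - b * z ^ 6) :
    ∀ᶠ z in 𝓝 0, p z = q z := by
  by_contra hne
  have hd : AnalyticAt ℂ (fun z => p z - q z) 0 := hp.sub hq
  have hne' : ¬ ∀ᶠ z in 𝓝 0, p z - q z = 0 := by simpa only [sub_eq_zero] using hne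
  obtain ⟨m, e, he, he0, hde⟩ := hd.exists_eventuallyEq_pow_smul_nonzero_iff.mpr hne'
  simp only [sub_zero, smul_eq_mul] at hde
  have hde' : deriv (fun z => p z - q z) =ᶠ[𝓝 0] deriv (fun z => z ^ m * e z) :=
    Filter.EventuallyEq.deriv hde
  -- With `p - q = z ^ m * e`, the difference of the two equations is divisible by `z ^ (m + 2)`.
  -- The quotient at `z = 0` reads `-4 m e(0) = 12 e(0)`, impossible for `m ≥ 0`.
  have key : ∀ᶠ z in 𝓝[≠] (0 : ℂ), (m * e z + z * deriv e z) *
      (-4 + z ^ 3 * (deriv p z + deriv q z)) =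
      e z * (4 * ((1 + z ^ 2 * p z) ^ 2 + (1 + z ^ 2 * p z) * (1 + z ^ 2 * q z)
        + (1 + z ^ 2 * q z) ^ 2) - a * z ^ 4) := by
    filter_upwards [hpe, hqe, hde.filter_mono nhdsWithin_le_nhds,
      hde'.filter_mono nhdsWithin_le_nhds, he.eventually_analyticAt.filter_mono nhdsWithin_le_nhds,
      hp.eventually_analyticAt.filter_mono nhdsWithin_le_nhds,
      hq.eventually_analyticAt.filter_mono nhdsWithin_le_nhds, self_mem_nhdsWithin]
      with z h1 h2 h3 h4 h5 h6 h7 hz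
    have hz : z ≠ 0 := hz
    rw [deriv_fun_sub h6.differentiableAt h7.differentiableAt,
      deriv_fun_mul (by fun_prop) h5.differentiableAt] at h4
    simp only [deriv_pow_field] at h4
    have h8 : z * (m * z ^ (m - 1)) = m * z ^ m := by
      rcases m with _ | m
      · simp
      · simp; ring
    have h9 : z ^ (m + 2) ≠ 0 := pow_ne_zero _ hz
    apply mul_left_cancel₀ h9
    have h10 : z * (deriv p z - deriv q z) = z ^ m * (m * e z + z * deriv e z) := by
      rw [h4]; linear_combination e z * h8
    have h11 : z ^ 2 * (z * (deriv p z - deriv q z)) * (-4 + z ^ 3 * (deriv p z + deriv q z)) =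
        z ^ 2 * (p z - q z) * (4 * ((1 + z ^ 2 * p z) ^ 2 + (1 + z ^ 2 * p z) * (1 + z ^ 2 * q z)
        + (1 + z ^ 2 * q z) ^ 2) - a * z ^ 4) := by
      linear_combination h1 - h2
    rw [h10, h3] at h11
    linear_combination h11
  have hp' := hp.deriv
  have hq' := hq.deriv
  have he' := he.deriv
  have hl := hp.continuousAt
  have hl2 := hq.continuousAt
  have hl3 := he.continuousAt
  have hl4 := hp'.continuousAt
  have hl5 := hq'.continuousAt
  have hl6 := he'.continuousAt
  have := ((ContinuousAt.eventuallyEq_nhds_iff_eventuallyEq_nhdsNE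
    (by fun_prop) (by fun_prop)).mp key).self_of_nhds
  simp at this
  have h2 : e 0 * (4 * (m + 3 : ℂ)) = 0 := by linear_combination -this
  have h3 : (4 * (m + 3 : ℂ)) ≠ 0 := by norm_cast
  exact (mul_ne_zero he0 h3) h2

/-- A solution of a homogeneous linear second order equation which vanishes to second order at a
point vanishes near that point. -/
theorem eventually_eq_zero_of_deriv_deriv_eq_mul {d h : ℂ → ℂ} {x : ℂ}
    (hd : AnalyticAt ℂ d x) (hh : ContinuousAt h x) (h0 : d x = 0) (h1 : deriv d x = 0)
    (hdh : ∀ᶠ z in 𝓝 x, deriv (deriv d) z = d z * h z) : ∀ᶠ z in 𝓝 x, d z = 0 := by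
  by_contra hne
  obtain ⟨m, e, he, he0, hde⟩ := hd.exists_eventuallyEq_pow_smul_nonzero_iff.mpr hne
  simp only [smul_eq_mul] at hde
  have hpow : ∀ n : ℕ, ∀ z, HasDerivAt (fun z : ℂ => (z - x) ^ (n + 1)) ((n + 1) * (z - x) ^ n) z :=
    fun n z => by simpa using ((hasDerivAt_id' z).sub_const x).fun_pow (n + 1)
  have hx := hde.self_of_nhds
  rcases m with _ | _ | n
  · simp_all
  · have h2 : deriv d x = e x := by
      rw [Filter.EventuallyEq.deriv_eq hde,
        ((hpow 0 x).fun_mul he.differentiableAt.hasDerivAt).deriv]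
      simp
    exact he0 (h2 ▸ h1)
  have hd1 : deriv d =ᶠ[𝓝 x] fun z =>
      (z - x) ^ (n + 1) * ((n + 2) * e z + (z - x) * deriv e z) := by
    refine (Filter.EventuallyEq.deriv hde).trans ?_
    filter_upwards [he.eventually_analyticAt] with z hz
    rw [((hpow (n + 1) z).fun_mul hz.differentiableAt.hasDerivAt).deriv]
    push_cast; ring
  have hd2 : deriv (deriv d) =ᶠ[𝓝 x] fun z => (z - x) ^ n *
      ((n + 1) * ((n + 2) * e z + (z - x) * deriv e z) +
       (z - x) * ((n + 3) * deriv e z + (z - x) * deriv (deriv e) z)) := by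
    refine (Filter.EventuallyEq.deriv hd1).trans ?_
    filter_upwards [he.eventually_analyticAt] with z hz
    rw [((hpow n z).fun_mul ((hz.differentiableAt.hasDerivAt.const_mul _).fun_add
      (((hasDerivAt_id' z).sub_const x).fun_mul hz.deriv.differentiableAt.hasDerivAt))).deriv]
    simp; ring
  -- Here `d` vanishes to order `n + 2`. After division by `(z - x) ^ n` the left side tends to `(n
  -- + 1)(n + 2) e(x) ≠ 0` and the right side to `0`.
  have key : ∀ᶠ z in 𝓝[≠] x, ((n + 1) * ((n + 2) * e z + (z - x) * deriv e z) +
       (z - x) * ((n + 3) * deriv e z + (z - x) * deriv (deriv e) z)) =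
       (z - x) ^ 2 * (e z * h z) := by
    filter_upwards [hd2.filter_mono nhdsWithin_le_nhds, hdh.filter_mono nhdsWithin_le_nhds,
      hde.filter_mono nhdsWithin_le_nhds, self_mem_nhdsWithin] with z h2 h3 h4 hz
    have h5 : (z - x) ^ n ≠ 0 := pow_ne_zero _ (sub_ne_zero.mpr hz)
    apply mul_left_cancel₀ h5
    rw [← h2, h3, h4]; ring
  have hl3 := he.continuousAt
  have hl6 := he.deriv.continuousAt
  have hl7 := he.deriv.deriv.continuousAt
  have := ((ContinuousAt.eventuallyEq_nhds_iff_eventuallyEq_nhdsNE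
    (by fun_prop) (by fun_prop)).mp key).self_of_nhds
  simp [he0] at this
  norm_cast at this

/-- The identity theorem on the complement of a countable set. -/
theorem eqOn_compl_of_eventuallyEq {f g : ℂ → ℂ} {S : Set ℂ} (hS : S.Countable)
    (hf : AnalyticOnNhd ℂ f Sᶜ) (hg : AnalyticOnNhd ℂ g Sᶜ) {x : ℂ}
    (h : ∀ᶠ z in 𝓝[≠] x, f z = g z) : Set.EqOn f g Sᶜ := by
  have hconn : IsPreconnected Sᶜ :=
    (hS.isPathConnected_compl_of_one_lt_rank (by simp)).isConnected.isPreconnected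
  have hd : Dense Sᶜ := hS.dense_compl ℝ
  -- The point `x` may lie in `S`, so the agreement is moved to a nearby point of the dense set
  -- `Sᶜ`.
  have h' : ∀ᶠ z in 𝓝[≠] x, ∀ᶠ w in 𝓝 z, f w = g w := by
    filter_upwards [eventually_eventually_nhdsWithin.mpr h, self_mem_nhdsWithin] with z hz hzx
    rwa [isOpen_compl_singleton.nhdsWithin_eq hzx] at hz
  obtain ⟨U, hU, hUo, hxU⟩ := mem_nhds_iff.mp (mem_nhdsWithin_iff_eventually.mp h')
  have hne : (U \ {x}).Nonempty := by
    have : (𝓝[≠] x).NeBot := inferInstance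
    exact this.nonempty_of_mem (Filter.inter_mem (mem_nhdsWithin_of_mem_nhds (hUo.mem_nhds hxU))
      self_mem_nhdsWithin)
  obtain ⟨z, hz, hzS⟩ := hd.inter_open_nonempty _ (hUo.sdiff isClosed_singleton) hne
  exact hf.eqOn_of_preconnected_of_eventuallyEq hg hconn hzS (hU hz.1 hz.2)

/-! ### The Weierstrass function: poles, periods, zeros of `℘'` -/

namespace PeriodPair
variable (L : PeriodPair)

theorem countable_lattice : (L.lattice : Set ℂ).Countable :=
  Set.countable_coe_iff.mp (L.latticeEquivProd.toEquiv.countable_iff.mpr inferInstance)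

theorem weierstrassP_eq_inv_sq_add (z : ℂ) :
    L.weierstrassP z = (z ^ 2)⁻¹ + L.weierstrassPExcept 0 z := by
  have := L.weierstrassPExcept_def 0 z
  simp at this
  rw [this]; ring

theorem eventually_notMem_lattice (x : ℂ) : ∀ᶠ z in 𝓝[≠] x, z ∉ L.lattice := by
  filter_upwards [mem_nhdsWithin_of_mem_nhds (L.compl_lattice_sdiff_singleton_mem_nhds x),
    self_mem_nhdsWithin] with z hz hzx hzL
  exact hz ⟨hzL, hzx⟩

theorem eventually_derivWeierstrassP_eq : ∀ᶠ z in 𝓝[≠] 0,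
    L.derivWeierstrassP z = -2 / z ^ 3 + deriv (L.weierstrassPExcept 0) z := by
  filter_upwards [self_mem_nhdsWithin,
    (L.analyticAt_weierstrassPExcept 0).eventually_analyticAt.filter_mono nhdsWithin_le_nhds]
    with z hz0 ha
  have hz0 : z ≠ 0 := hz0
  rw [← L.deriv_weierstrassP, show L.weierstrassP = fun z => (z ^ 2)⁻¹ + L.weierstrassPExcept 0 z
    from funext L.weierstrassP_eq_inv_sq_add,
    (((hasDerivAt_pow 2 z).fun_inv (pow_ne_zero 2 hz0)).fun_add
    ha.differentiableAt.hasDerivAt).deriv]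
  field_simp
  norm_num
  ring

/-- Multiplying the Weierstrass equation by `z ^ 6` makes every term analytic at `0`, the form
needed to compare germs. -/
theorem weierstrassPExcept_zero_equation : ∀ᶠ z in 𝓝[≠] 0,
    (-2 + z ^ 3 * deriv (L.weierstrassPExcept 0) z) ^ 2 =
      4 * (1 + z ^ 2 * L.weierstrassPExcept 0 z) ^ 3
        - L.g₂ * z ^ 4 * (1 + z ^ 2 * L.weierstrassPExcept 0 z) - L.g₃ * z ^ 6 := by
  filter_upwards [L.eventually_notMem_lattice 0, self_mem_nhdsWithin,
    L.eventually_derivWeierstrassP_eq] with z hz hz0 h1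
  have hz0 : z ≠ 0 := hz0
  have h2 := L.derivWeierstrassP_sq z hz
  rw [h1, L.weierstrassP_eq_inv_sq_add] at h2
  field_simp at h2
  linear_combination h2

/-- The order depends only on the punctured germ, so this recovers the lattice from the values of
`℘` off a countable closed set of poles. -/
theorem mem_lattice_iff_order (x : ℂ) : x ∈ L.lattice ↔ meromorphicOrderAt L.weierstrassP x < 0 := by
  refine ⟨fun h => by rw [L.order_weierstrassP x h]; decide, fun h => ?_⟩
  by_contra hx
  exact absurd (L.analyticOnNhd_weierstrassP x hx).meromorphicOrderAt_nonneg (not_le.mpr h)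

/-- The invariants determine the lattice. -/
theorem lattice_eq_of_invariants_eq {L₁ L₂ : PeriodPair} (h2 : L₁.g₂ = L₂.g₂)
    (h3 : L₁.g₃ = L₂.g₃) : L₁.lattice = L₂.lattice := by
  have h := eventuallyEq_of_weierstrass_equation (L₁.analyticAt_weierstrassPExcept 0)
    (L₂.analyticAt_weierstrassPExcept 0) L₁.weierstrassPExcept_zero_equation
    (by simpa only [h2, h3] using L₂.weierstrassPExcept_zero_equation)
  have h' : ∀ᶠ z in 𝓝[≠] 0, L₁.weierstrassP z = L₂.weierstrassP z := by
    filter_upwards [h.filter_mono nhdsWithin_le_nhds] with z hz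
    rw [L₁.weierstrassP_eq_inv_sq_add, L₂.weierstrassP_eq_inv_sq_add, hz]
  have heq := eqOn_compl_of_eventuallyEq (S := L₁.lattice ∪ L₂.lattice)
    (L₁.countable_lattice.union L₂.countable_lattice)
    (L₁.analyticOnNhd_weierstrassP.mono (by simp)) (L₂.analyticOnNhd_weierstrassP.mono (by simp)) h'
  ext x
  rw [L₁.mem_lattice_iff_order, L₂.mem_lattice_iff_order, meromorphicOrderAt_congr]
  filter_upwards [L₁.eventually_notMem_lattice x, L₂.eventually_notMem_lattice x] with z h1 h2
  exact heq (by simp [h1, h2])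

/-- A period `T` outside the lattice would carry continuity of `℘` at `T` to the pole `0`. -/
theorem periodic_weierstrassP_iff (T : ℂ) : Function.Periodic L.weierstrassP T ↔ T ∈ L.lattice := by
  refine ⟨fun h => ?_, fun h => L.periodic_weierstrassP ⟨T, h⟩⟩
  by_contra hT
  apply L.not_continuousAt_weierstrassP 0 (zero_mem _)
  have h1 : ContinuousAt L.weierstrassP (0 + T) := by
    simpa using (L.analyticOnNhd_weierstrassP T hT).continuousAt
  have h2 : ContinuousAt (fun z => L.weierstrassP (z + T)) 0 :=
    ContinuousAt.comp (f := fun z : ℂ => z + T) h1 (by fun_prop)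
  exact h2.congr (Eventually.of_forall fun z => h z)

theorem hasDerivAt_weierstrassP {z : ℂ} (hz : z ∉ L.lattice) :
    HasDerivAt L.weierstrassP (L.derivWeierstrassP z) z := by
  rw [← L.deriv_weierstrassP]
  exact (L.analyticOnNhd_weierstrassP z hz).differentiableAt.hasDerivAt

/-- Otherwise the identity theorem makes `℘'` vanish off the lattice, whereas `z³ ℘'(z)` tends to
`-2` at `0`. -/
theorem not_eventually_derivWeierstrassP_eq_zero (z : ℂ) :
    ¬ ∀ᶠ w in 𝓝 z, L.derivWeierstrassP w = 0 := by
  intro h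
  have h1 := eqOn_compl_of_eventuallyEq L.countable_lattice
    L.analyticOnNhd_derivWeierstrassP (g := fun _ => 0) analyticOnNhd_const
    (h.filter_mono nhdsWithin_le_nhds)
  have h2 : ∀ᶠ z in 𝓝[≠] 0, -2 + z ^ 3 * deriv (L.weierstrassPExcept 0) z = 0 := by
    filter_upwards [L.eventually_notMem_lattice 0, self_mem_nhdsWithin,
      L.eventually_derivWeierstrassP_eq] with z hz hz0 h3
    have hz0 : z ≠ 0 := hz0
    have h4 := h1 hz
    rw [h3] at h4
    field_simp at h4
    linear_combination h4
  have hc := (L.analyticAt_weierstrassPExcept 0).deriv.continuousAt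
  have := ((ContinuousAt.eventuallyEq_nhds_iff_eventuallyEq_nhdsNE (by fun_prop)
    continuousAt_const).mp h2).self_of_nhds
  simp at this

/-- Differentiating the Weierstrass equation gives this up to a factor `℘'`, which can be cancelled
because its zeros fill no open set. -/
theorem deriv_derivWeierstrassP {z : ℂ} (hz : z ∉ L.lattice) :
    deriv L.derivWeierstrassP z = 6 * L.weierstrassP z ^ 2 - L.g₂ / 2 := by
  have hopen := L.isClosed_lattice.isOpen_compl
  have hmul : ∀ w ∉ L.lattice, L.derivWeierstrassP w *
      (deriv L.derivWeierstrassP w - (6 * L.weierstrassP w ^ 2 - L.g₂ / 2)) = 0 := by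
    intro w hw
    have e : (fun z => L.derivWeierstrassP z ^ 2) =ᶠ[𝓝 w] fun z =>
        4 * L.weierstrassP z ^ 3 - L.g₂ * L.weierstrassP z - L.g₃ := by
      filter_upwards [hopen.mem_nhds hw] with v hv using L.derivWeierstrassP_sq v hv
    have h1 := ((L.analyticOnNhd_derivWeierstrassP w hw).differentiableAt.hasDerivAt.pow 2).deriv
    have hP := L.hasDerivAt_weierstrassP hw
    have h2 := ((((hP.pow 3).const_mul 4).sub (hP.const_mul L.g₂)).sub_const L.g₃).deriv
    have h3 := e.deriv_eq
    erw [h1, h2] at h3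
    linear_combination (1 / 2 : ℂ) * h3
  by_contra hne
  apply L.not_eventually_derivWeierstrassP_eq_zero z
  have hc : ContinuousAt (fun w => deriv L.derivWeierstrassP w -
      (6 * L.weierstrassP w ^ 2 - L.g₂ / 2)) z := by
    have h1 := (L.analyticOnNhd_derivWeierstrassP z hz).deriv.continuousAt
    have h2 := (L.analyticOnNhd_weierstrassP z hz).continuousAt
    fun_prop
  filter_upwards [hc.eventually_ne (sub_ne_zero.mpr hne), hopen.mem_nhds hz] with w hw hwL
  exact (mul_eq_zero.mp (hmul w hwL)).resolve_right hw

/-- The zeros of `℘'` are half-periods. -/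
theorem two_mul_mem_lattice_of_derivWeierstrassP_eq_zero {x : ℂ} (hx : x ∉ L.lattice)
    (h : L.derivWeierstrassP x = 0) : 2 * x ∈ L.lattice := by
  -- Both `℘` and its reflection `r` about `x` solve `y'' = 6y² - g₂/2`, with equal values and zero
  -- slope at `x`. Their difference satisfies `d'' = 6(℘ + r) d`, so it vanishes.
  set r : ℂ → ℂ := fun z => L.weierstrassP (2 * x - z) with hr
  have hopen := L.isClosed_lattice.isOpen_compl
  have hmem : ∀ᶠ z in 𝓝 x, 2 * x - z ∉ L.lattice := by
    have : ContinuousAt (fun z : ℂ => 2 * x - z) x := by fun_prop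
    exact this.eventually_mem (hopen.mem_nhds (by simpa [two_mul] using hx))
  have hra : ∀ z, 2 * x - z ∉ L.lattice → AnalyticAt ℂ r z := fun z hz =>
    (L.analyticOnNhd_weierstrassP _ hz).comp (f := fun z => 2 * x - z) (by fun_prop)
  have hrd : ∀ z, 2 * x - z ∉ L.lattice → deriv r z = - L.derivWeierstrassP (2 * x - z) := by
    intro z hz
    have : HasDerivAt r _ z :=
      (L.hasDerivAt_weierstrassP hz).comp z ((hasDerivAt_id' z).const_sub (2 * x))
    simpa using this.deriv
  have hrd2 : ∀ᶠ z in 𝓝 x, deriv (deriv r) z = 6 * r z ^ 2 - L.g₂ / 2 := by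
    filter_upwards [hmem, hmem.eventually_nhds] with z hz hz'
    have e : deriv r =ᶠ[𝓝 z] fun z => - L.derivWeierstrassP (2 * x - z) := by
      filter_upwards [hz'] with w hw using hrd w hw
    rw [e.deriv_eq, hr, ← L.deriv_derivWeierstrassP hz]
    have : HasDerivAt (fun z => - L.derivWeierstrassP (2 * x - z)) _ z :=
      (((L.analyticOnNhd_derivWeierstrassP _ hz).differentiableAt.hasDerivAt.comp z
      ((hasDerivAt_id' z).const_sub (2 * x)))).neg
    rw [this.deriv]
    ring
  have hx2 : 2 * x - x = x := by ring
  have hxr : 2 * x - x ∉ L.lattice := by rwa [hx2]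
  have hPa := L.analyticOnNhd_weierstrassP x hx
  have key : ∀ᶠ z in 𝓝 x, L.weierstrassP z - r z = 0 := by
    refine eventually_eq_zero_of_deriv_deriv_eq_mul (d := fun z => L.weierstrassP z - r z)
      (h := fun z => 6 * (L.weierstrassP z + r z)) (hPa.sub (hra x hxr)) ?_ ?_ ?_ ?_
    · exact continuousAt_const.mul (hPa.continuousAt.add (hra x hxr).continuousAt)
    · simp [hr, hx2]
    · rw [deriv_fun_sub hPa.differentiableAt (hra x hxr).differentiableAt, hrd x hxr,
        L.deriv_weierstrassP, hx2, h]
      simp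
    · have e : deriv (fun z => L.weierstrassP z - r z) =ᶠ[𝓝 x]
          fun z => L.derivWeierstrassP z - deriv r z := by
        filter_upwards [hmem, hopen.mem_nhds hx] with z hz hz2
        rw [deriv_fun_sub (L.analyticOnNhd_weierstrassP z hz2).differentiableAt
          (hra z hz).differentiableAt, L.deriv_weierstrassP]
      filter_upwards [e.eventuallyEq_nhds, hrd2, hopen.mem_nhds hx, hmem] with z h1 h2 h3 h4
      rw [h1.deriv_eq, deriv_fun_sub (L.analyticOnNhd_derivWeierstrassP z h3).differentiableAt
          (hra z h4).deriv.differentiableAt, h2, L.deriv_derivWeierstrassP h3]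
      ring
  have hcount : ((fun z => 2 * x - z) ⁻¹' (L.lattice : Set ℂ)).Countable :=
    L.countable_lattice.preimage (fun a b hab => by simpa using hab)
  have heq := eqOn_compl_of_eventuallyEq (f := L.weierstrassP) (g := r)
    (S := L.lattice ∪ (fun z => 2 * x - z) ⁻¹' (L.lattice : Set ℂ))
    (L.countable_lattice.union hcount)
    (L.analyticOnNhd_weierstrassP.mono (by simp))
    (fun z hz => hra z (by simp at hz; exact hz.2))
    (x := x) ((key.mono fun z hz => sub_eq_zero.mp hz).filter_mono nhdsWithin_le_nhds)
  -- If `2 * x` were not a lattice point, `r` would be analytic at `0`, where `℘` has a pole.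
  by_contra hmem2
  have h0 : ∀ᶠ z in 𝓝 (0 : ℂ), 2 * x - z ∉ L.lattice := by
    have : ContinuousAt (fun z : ℂ => 2 * x - z) 0 := by fun_prop
    exact this.eventually_mem (hopen.mem_nhds (by simpa using hmem2))
  have hord : meromorphicOrderAt L.weierstrassP 0 = meromorphicOrderAt r 0 := by
    apply meromorphicOrderAt_congr
    filter_upwards [h0.filter_mono nhdsWithin_le_nhds, L.eventually_notMem_lattice 0] with z h1 h2
    exact heq (by simp [h1, h2])
  have h2 := (L.mem_lattice_iff_order 0).mp (zero_mem _)
  rw [hord] at h2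
  exact absurd (hra 0 (by simpa using hmem2)).meromorphicOrderAt_nonneg (not_le.mpr h2)

end PeriodPair

/-! ### Eisenstein series on the imaginary axis -/

/-- The normalised Eisenstein series along the imaginary axis. -/
noncomputable def eisensteinAxis {k : ℕ} (hk : 3 ≤ k) (t : ℝ) : ℂ :=
  ModularForm.E hk (UpperHalfPlane.ofComplex (t * Complex.I))

theorem im_ofReal_mul_I (t : ℝ) : ((t : ℂ) * Complex.I).im = t := by simp

theorem ofComplex_mul_I {t : ℝ} (ht : 0 < t) :
    ((UpperHalfPlane.ofComplex (t * Complex.I) : UpperHalfPlane) : ℂ) = t * Complex.I := by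
  rw [UpperHalfPlane.ofComplex_apply_of_im_pos (by simpa using ht)]

theorem continuousOn_eisensteinAxis {k : ℕ} (hk : 3 ≤ k) :
    ContinuousOn (eisensteinAxis hk) (Set.Ioi 0) := by
  have h := (UpperHalfPlane.mdifferentiable_iff.mp (ModularFormClass.holo (ModularForm.E hk))).continuousOn
  exact h.comp (f := fun t : ℝ => (t : ℂ) * Complex.I) (by fun_prop) (fun t ht => by simpa using ht)

/-- The constant term of the `q`-expansion is `1`, and the rest decays exponentially. -/
theorem tendsto_eisensteinAxis {k : ℕ} (hk : 3 ≤ k) (hk2 : Even k) :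
    Tendsto (eisensteinAxis hk) atTop (𝓝 1) := by
  obtain ⟨c, hc, hO⟩ := ModularFormClass.exp_decay_sub_atImInfty' (ModularForm.E hk)
  have hv : UpperHalfPlane.valueAtInfty (ModularForm.E hk) = 1 := by
    rw [← EisensteinSeries.E_qExpansion_coeff_zero hk hk2]
    refine (UpperHalfPlane.qExpansion_coeff_zero one_pos ?_ ?_).symm
    · exact ModularFormClass.analyticAt_cuspFunction_zero _ one_pos one_mem_strictPeriods_SL
    · exact SlashInvariantFormClass.periodic_comp_ofComplex _ one_mem_strictPeriods_SL
  rw [hv] at hO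
  have him : Tendsto (fun t : ℝ => UpperHalfPlane.ofComplex (t * Complex.I)) atTop
      UpperHalfPlane.atImInfty := by
    refine UpperHalfPlane.tendsto_comap_im_ofComplex.comp ?_
    rw [tendsto_comap_iff]
    exact tendsto_id.congr fun t => by simp
  have h1 := hO.comp_tendsto him
  have h2 : Tendsto (fun t : ℝ => Real.exp (-c * (UpperHalfPlane.ofComplex
      (t * Complex.I)).im)) atTop (𝓝 0) := by
    have : Tendsto (fun t : ℝ => Real.exp (-c * t)) atTop (𝓝 0) := by
      refine Real.tendsto_exp_atBot.comp ?_
      exact tendsto_id.const_mul_atTop_of_neg (by linarith)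
    refine this.congr' ?_
    filter_upwards [eventually_gt_atTop 0] with t ht
    rw [← UpperHalfPlane.coe_im, ofComplex_mul_I ht, im_ofReal_mul_I]
  have h3 := (h1.trans_tendsto h2).add_const (1 : ℂ)
  rw [zero_add] at h3
  exact h3.congr fun t => by simp [eisensteinAxis]

/-- The modular transformation `τ ↦ -1/τ` sends `it` to `i/t`. -/
theorem eisensteinAxis_inv {k : ℕ} (hk : 3 ≤ k) {t : ℝ} (ht : 0 < t) :
    eisensteinAxis hk t⁻¹ = (t * Complex.I) ^ k * eisensteinAxis hk t := by
  have hS : UpperHalfPlane.ofComplex ((t⁻¹ : ℝ) * Complex.I) =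
      ModularGroup.S • UpperHalfPlane.ofComplex (t * Complex.I) := by
    apply UpperHalfPlane.ext
    rw [ofComplex_mul_I (inv_pos.mpr ht), UpperHalfPlane.modular_S_smul]
    simp only [ofComplex_mul_I ht]
    rw [inv_neg, mul_inv, Complex.inv_I]
    push_cast
    ring
  unfold eisensteinAxis
  rw [hS]
  have := SlashInvariantForm.slash_action_eqn'' (ModularForm.E hk)
    (γ := (ModularGroup.S : GL (Fin 2) ℝ)) (MonoidHom.mem_range.mpr ⟨ModularGroup.S, rfl⟩)
    (UpperHalfPlane.ofComplex (t * Complex.I))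
  rw [ModularGroup.denom_S, ofComplex_mul_I ht] at this
  exact_mod_cast this

theorem eisensteinAxis_eq_ofReal {k : ℕ} (hk : 3 ≤ k) (hk2 : Even k) {t : ℝ} (ht : 0 < t) :
    eisensteinAxis hk t = ((1 - (2 * k / bernoulli k) * ∑' n : ℕ+,
      (ArithmeticFunction.sigma (k - 1) n) * Real.exp (-2 * Real.pi * t) ^ (n : ℕ) : ℝ) : ℂ) := by
  unfold eisensteinAxis
  rw [EisensteinSeries.q_expansion_bernoulli hk hk2, ofComplex_mul_I ht]
  have : 2 * Real.pi * Complex.I * (t * Complex.I) = ((-2 * Real.pi * t : ℝ) : ℂ) := by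
    push_cast; linear_combination (2 * Real.pi * t : ℂ) * Complex.I_sq
  rw [this]
  push_cast
  simp

/-- As `B₄ = -1/30`, the nonconstant terms carry the factor `+240`. The bound allows division by
`E₄` and by its square root. -/
theorem one_le_eisensteinAxis_four {t : ℝ} (ht : 0 < t) :
    1 ≤ (eisensteinAxis (k := 4) (by norm_num) t).re := by
  rw [eisensteinAxis_eq_ofReal _ (by decide) ht, Complex.ofReal_re,
    show bernoulli 4 = -1 / 30 by decide +kernel]
  have : 0 ≤ ∑' n : ℕ+, (ArithmeticFunction.sigma (4 - 1) n : ℝ) *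
    Real.exp (-2 * Real.pi * t) ^ (n : ℕ) := tsum_nonneg fun n => by positivity
  norm_num at this ⊢
  linarith

/-! ### Rectangular lattices with prescribed invariants -/

namespace PeriodPair

/-- Scaling by `a` reduces the lattice sum to that of `ℤ + itℤ`. The coordinates are swapped because
`eisSummand` puts the coefficient of `τ` first. -/
theorem G_eq_of_rectangular {L : PeriodPair} {a t : ℝ} (ht : 0 < t) (h1 : L.ω₁ = a)
    (h2 : L.ω₂ = a * (t * Complex.I)) {k : ℕ} (hk : 3 ≤ k) :
    L.G k = ((a : ℂ) ^ k)⁻¹ * (2 * riemannZeta k * eisensteinAxis hk t) := by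
  have hE := tsum_eisSummand_eq_riemannZeta_mul_eisensteinSeries hk
    (UpperHalfPlane.ofComplex (t * Complex.I))
  have hE2 : eisensteinAxis hk t = (1 / 2 : ℂ) *
    eisensteinSeries (N := 1) 0 k (UpperHalfPlane.ofComplex (t * Complex.I)) := rfl
  rw [show 2 * riemannZeta k * eisensteinAxis hk t = riemannZeta k *
    eisensteinSeries (N := 1) 0 k (UpperHalfPlane.ofComplex (t * Complex.I)) by
      rw [hE2]; ring, ← hE, ← tsum_mul_left, G, ← L.latticeEquivProd.symm.toEquiv.tsum_eq,
      ← ((Equiv.prodComm ℤ ℤ).trans (finTwoArrowEquiv ℤ).symm).tsum_eq]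
  refine tsum_congr fun x => ?_
  simp only [LinearEquiv.coe_toEquiv, latticeEquiv_symm_apply, h1, h2,
    EisensteinSeries.eisSummand, ofComplex_mul_I ht]
  simp [← mul_inv, ← mul_pow]
  ring

theorem _root_.riemannZeta_six : riemannZeta 6 = Real.pi ^ 6 / 945 := by
  have := riemannZeta_two_mul_nat (k := 3) (by norm_num)
  norm_num [show bernoulli 6 = 1 / 42 by decide +kernel, Nat.factorial] at this
  rw [this]; ring

/-- The ratio `E₆ / E₄^(3/2)` tends to `1` at infinity and changes sign under `t ↦ 1/t`, so the
intermediate value theorem gives all of `(-1, 1)`. -/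
theorem _root_.exists_eisensteinAxis_ratio {c : ℝ} (hc : |c| < 1) : ∃ t : ℝ, 0 < t ∧
    (eisensteinAxis (k := 6) (by norm_num) t).re =
      c * ((eisensteinAxis (k := 4) (by norm_num) t).re *
        √(eisensteinAxis (k := 4) (by norm_num) t).re) := by
  set e4 : ℝ → ℝ := fun t => (eisensteinAxis (k := 4) (by norm_num) t).re with he4
  set e6 : ℝ → ℝ := fun t => (eisensteinAxis (k := 6) (by norm_num) t).re with he6
  have h4pos : ∀ t, 0 < t → 0 < e4 t := fun t ht =>
    lt_of_lt_of_le one_pos (one_le_eisensteinAxis_four ht)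
  have c4 : ContinuousOn e4 (Set.Ioi 0) :=
    Complex.continuous_re.comp_continuousOn (continuousOn_eisensteinAxis _)
  have c6 : ContinuousOn e6 (Set.Ioi 0) :=
    Complex.continuous_re.comp_continuousOn (continuousOn_eisensteinAxis _)
  set r : ℝ → ℝ := fun t => e6 t / (e4 t * √(e4 t)) with hr
  have cr : ContinuousOn r (Set.Ioi 0) := by
    refine c6.div (c4.mul c4.sqrt) fun t ht => ?_
    have := h4pos t ht
    positivity
  have l4 : Tendsto e4 atTop (𝓝 1) := by
    rw [← Complex.one_re]
    exact (Complex.continuous_re.tendsto 1).comp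
      (tendsto_eisensteinAxis (k := 4) (by norm_num) (by decide))
  have l6 : Tendsto e6 atTop (𝓝 1) := by
    rw [← Complex.one_re]
    exact (Complex.continuous_re.tendsto 1).comp
      (tendsto_eisensteinAxis (k := 6) (by norm_num) (by decide))
  have lr : Tendsto r atTop (𝓝 1) := by
    have h := l6.div (l4.mul l4.sqrt) (by norm_num)
    rw [Real.sqrt_one, mul_one, div_one] at h
    exact h
  -- The powers of `t` cancel, since `t ^ 6 = (t ^ 4)^(3/2)`; the sign is `I ^ 6 = -1` against `I ^
  -- 4 = 1`.
  have hinv : ∀ t, 0 < t → r t⁻¹ = - r t := by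
    intro t ht
    have h4 : e4 t⁻¹ = t ^ 4 * e4 t := by
      simp only [he4]
      rw [eisensteinAxis_inv _ ht, mul_pow, Complex.I_pow_four, mul_one, ← Complex.ofReal_pow,
        Complex.re_ofReal_mul]
    have h6 : e6 t⁻¹ = - (t ^ 6 * e6 t) := by
      simp only [he6]
      rw [eisensteinAxis_inv _ ht, mul_pow, show Complex.I ^ 6 = -1 by
        rw [show (6 : ℕ) = 2 * 3 by rfl, pow_mul, Complex.I_sq]; norm_num,
        show (t : ℂ) ^ 6 * -1 = ((-t ^ 6 : ℝ) : ℂ) by push_cast; ring, Complex.re_ofReal_mul]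
      ring
    have hp := h4pos t ht
    simp only [hr, h4, h6]
    rw [show t ^ 4 * e4 t = (t ^ 2) ^ 2 * e4 t by ring, Real.sqrt_mul (by positivity),
      Real.sqrt_sq (by positivity)]
    field_simp
  obtain ⟨t, htr, ht⟩ := ((lr.eventually_const_lt hc).and (eventually_gt_atTop 0)).exists
  have hmem : c ∈ Set.Icc (r t⁻¹) (r t) := by
    rw [hinv t ht]
    have := abs_lt.mp (lt_of_le_of_lt le_rfl htr)
    exact ⟨this.1.le, this.2.le⟩
  obtain ⟨s, hs, hsc⟩ := isPreconnected_Ioi.intermediate_value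
    (Set.mem_Ioi.mpr (inv_pos.mpr ht)) (Set.mem_Ioi.mpr ht) cr hmem
  refine ⟨s, hs, ?_⟩
  have := h4pos s hs
  rw [hr] at hsc
  field_simp at hsc
  change e6 s = c * (e4 s * √(e4 s))
  linear_combination hsc

/-- The period pair of a rectangular lattice. -/
noncomputable def rectangular (a t : ℝ) (ha : 0 < a) (ht : 0 < t) : PeriodPair where
  ω₁ := a
  ω₂ := a * (t * Complex.I)
  indep := by
    rw [LinearIndependent.pair_iff]
    intro x y h
    have h1 := congrArg Complex.re h
    have h2 := congrArg Complex.im h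
    simp at h1 h2
    exact ⟨h1.resolve_right ha.ne', by
      rcases h2 with h | h | h
      · exact h
      · exact absurd h ha.ne'
      · exact absurd h ht.ne'⟩

/-- Every pair of real invariants with positive discriminant comes from a rectangular lattice. -/
theorem exists_rectangular {g₂ g₃ : ℝ} (h : 27 * g₃ ^ 2 < g₂ ^ 3) :
    ∃ (a t : ℝ) (ha : 0 < a) (ht : 0 < t),
      (rectangular a t ha ht).g₂ = g₂ ∧ (rectangular a t ha ht).g₃ = g₃ := by
  have hg2 : 0 < g₂ := by
    by_contra hle
    have : g₂ ^ 3 ≤ 0 := by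
      rw [show g₂ ^ 3 = g₂ * g₂ ^ 2 by ring]
      exact mul_nonpos_of_nonpos_of_nonneg (not_lt.mp hle) (sq_nonneg _)
    nlinarith [sq_nonneg g₃]
  have hs := Real.sq_sqrt hg2.le
  have hsp := Real.sqrt_pos.mpr hg2
  have h3 := Real.sq_sqrt (show (0 : ℝ) ≤ 3 by norm_num)
  have h3p := Real.sqrt_pos.mpr (show (0 : ℝ) < 3 by norm_num)
  -- For a rectangular lattice `g₂ = 4π⁴E₄ / (3a⁴)` and `g₃ = 8π⁶E₆ / (27a⁶)`, so `E₆ / E₄^(3/2)` is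
  -- the scale-invariant `3√3 g₃ / g₂^(3/2)`; it lies in `(-1, 1)` exactly when the discriminant is
  -- positive.
  obtain ⟨t, ht, hte⟩ := exists_eisensteinAxis_ratio (c := 3 * √3 * g₃ / (g₂ * √g₂)) (by
    rw [← sq_lt_one_iff_abs_lt_one, sq, div_mul_div_comm, div_lt_one (by positivity)]
    calc 3 * √3 * g₃ * (3 * √3 * g₃) = 27 * g₃ ^ 2 := by linear_combination 9 * g₃ ^ 2 * h3
      _ < g₂ ^ 3 := h
      _ = _ := by linear_combination -g₂ ^ 2 * hs)
  have h4r : eisensteinAxis (k := 4) (by norm_num) t =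
      ((eisensteinAxis (k := 4) (by norm_num) t).re : ℂ) := by
    rw [eisensteinAxis_eq_ofReal _ (by decide) ht, Complex.ofReal_re]
  have h6r : eisensteinAxis (k := 6) (by norm_num) t =
      ((eisensteinAxis (k := 6) (by norm_num) t).re : ℂ) := by
    rw [eisensteinAxis_eq_ofReal _ (by decide) ht, Complex.ofReal_re]
  have hep := lt_of_lt_of_le one_pos (one_le_eisensteinAxis_four ht)
  set e4 := (eisensteinAxis (k := 4) (by norm_num) t).re
  set e6 := (eisensteinAxis (k := 6) (by norm_num) t).re
  have he := Real.sq_sqrt hep.le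
  have hsep := Real.sqrt_pos.mpr hep
  -- This is `a²`, solved from the formula for `g₂`.
  set b : ℝ := 2 * Real.pi ^ 2 * √e4 / (√3 * √g₂) with hb
  have hbp : 0 < b := by positivity
  have ha2 := Real.sq_sqrt hbp.le
  have hap := Real.sqrt_pos.mpr hbp
  refine ⟨√b, t, hap, ht, ?_, ?_⟩
  · rw [PeriodPair.g₂, G_eq_of_rectangular ht rfl rfl (by norm_num : 3 ≤ 4), h4r]
    have h4 : (√b) ^ 4 = 4 * Real.pi ^ 4 * e4 / (3 * g₂) := by
      rw [show (√b) ^ 4 = ((√b) ^ 2) ^ 2 by ring, ha2, hb, div_pow, mul_pow, mul_pow, mul_pow,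
        he, h3, hs]
      ring
    rw [← Complex.ofReal_pow, h4]
    norm_num [riemannZeta_four]
    have : (e4 : ℂ) ≠ 0 := by exact_mod_cast hep.ne'
    have : (g₂ : ℂ) ≠ 0 := by exact_mod_cast hg2.ne'
    have : (Real.pi : ℂ) ≠ 0 := by exact_mod_cast Real.pi_ne_zero
    field_simp
    norm_num
  · rw [PeriodPair.g₃, G_eq_of_rectangular ht rfl rfl (by norm_num : 3 ≤ 6), h6r]
    have h6 : (√b) ^ 6 * g₃ = 8 * Real.pi ^ 6 / 27 * e6 := by
      rw [show (√b) ^ 6 = ((√b) ^ 2) ^ 3 by ring, ha2, hte, hb]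
      rw [div_pow, mul_pow, mul_pow, mul_pow, show √e4 ^ 3 = e4 * √e4 by rw [pow_succ, he],
        show √3 ^ 3 = 3 * √3 by rw [pow_succ, h3], show √g₂ ^ 3 = g₂ * √g₂ by rw [pow_succ, hs]]
      field_simp
      linear_combination (-72 * g₃) * h3
    have hne : ((√b : ℝ) : ℂ) ^ 6 ≠ 0 := by
      exact_mod_cast (pow_pos hap 6).ne'
    have h6' : ((√b : ℝ) : ℂ) ^ 6 * g₃ = 8 * Real.pi ^ 6 / 27 * e6 := by exact_mod_cast h6
    rw [show riemannZeta ((6 : ℕ) : ℂ) = Real.pi ^ 6 / 945 by exact_mod_cast riemannZeta_six,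
      inv_mul_eq_div, mul_div_assoc', div_eq_iff hne]
    linear_combination -h6'

end PeriodPair

/-! ### Power series with polynomially bounded coefficients -/

section PowerSeries

theorem summable_succ_pow_mul_geometric (p : ℕ) {r : ℝ} (hr0 : 0 < r) (hr1 : r < 1) :
    Summable fun n : ℕ => ((n : ℝ) + 1) ^ p * r ^ n := by
  have h := (summable_nat_add_iff 1).mpr (summable_pow_mul_geometric_of_norm_lt_one p
    (r := r) (by rwa [Real.norm_of_nonneg hr0.le]))
  refine (h.mul_right r⁻¹).congr fun n => ?_
  push_cast
  field_simp
  ring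

variable {a : ℕ → ℝ} {C : ℝ} {p : ℕ}

theorem summable_mul_pow_of_polynomial_bound (ha : ∀ n, |a n| ≤ C * ((n : ℝ) + 1) ^ p) {x : ℝ}
    (hx : |x| < 1) : Summable fun n => a n * x ^ n := by
  obtain ⟨r, hxr, hr⟩ := exists_between hx
  have hr0 : 0 < r := lt_of_le_of_lt (abs_nonneg x) hxr
  refine Summable.of_norm_bounded ((summable_succ_pow_mul_geometric p hr0 hr).mul_left C)
    fun n => ?_
  rw [Real.norm_eq_abs, abs_mul, abs_pow, ← mul_assoc]
  have := (abs_nonneg _).trans (ha n)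
  gcongr
  exact ha n

/-- Termwise differentiation is dominated on `(-r, r)` with `|x| < r < 1`. The new coefficients are
again polynomially bounded, so the argument can be repeated. -/
theorem hasDerivAt_tsum_mul_pow (ha : ∀ n, |a n| ≤ C * ((n : ℝ) + 1) ^ p) {x : ℝ}
    (hx : |x| < 1) :
    HasDerivAt (fun x => ∑' n, a n * x ^ n) (∑' n : ℕ, ((n : ℝ) + 1) * a (n + 1) * x ^ n) x := by
  obtain ⟨r, hxr, hr⟩ := exists_between hx
  have hr0 : 0 < r := lt_of_le_of_lt (abs_nonneg x) hxr
  have hb : ∀ (n : ℕ) (y : ℝ), y ∈ Set.Ioo (-r) r → ‖a n * (n * y ^ (n - 1))‖ ≤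
      C * r⁻¹ * (((n : ℝ) + 1) ^ (p + 1) * r ^ n) := by
    intro n y hy
    have hy' : |y| ≤ r := (abs_lt.mpr hy).le
    have hC := (abs_nonneg _).trans (ha n)
    rcases n with _ | n
    · have : 0 ≤ C := by simpa using hC
      simp; positivity
    · rw [Real.norm_eq_abs, abs_mul, abs_mul, abs_pow, Nat.abs_cast, Nat.add_sub_cancel]
      calc |a (n + 1)| * (((n + 1 : ℕ) : ℝ) * |y| ^ n)
          ≤ (C * (((n + 1 : ℕ) : ℝ) + 1) ^ p) * ((((n + 1 : ℕ) : ℝ) + 1) * r ^ n) := by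
            gcongr
            · exact ha _
            · linarith
        _ = _ := by rw [pow_succ r n]; field_simp; ring
  have hu : Summable fun n : ℕ => C * r⁻¹ * (((n : ℝ) + 1) ^ (p + 1) * r ^ n) :=
    (summable_succ_pow_mul_geometric (p + 1) hr0 hr).mul_left _
  have hxm : x ∈ Set.Ioo (-r) r := abs_lt.mp hxr
  have h := hasDerivAt_tsum_of_isPreconnected (g := fun n x => a n * x ^ n)
    (g' := fun n x => a n * (n * x ^ (n - 1))) hu isOpen_Ioo isPreconnected_Ioo
    (fun n y _ => (hasDerivAt_pow n y).const_mul (a n)) hb hxm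
    (summable_mul_pow_of_polynomial_bound ha hx) hxm
  have hs : Summable fun n : ℕ => a n * (n * x ^ (n - 1)) :=
    Summable.of_norm_bounded hu fun n => hb n x hxm
  rw [hs.tsum_eq_zero_add] at h
  refine h.congr_deriv ?_
  simp only [Nat.cast_zero, zero_mul, mul_zero, zero_add, Nat.add_sub_cancel]
  refine tsum_congr fun n => ?_
  push_cast; ring

theorem hasSum_mul_shift {s x : ℝ} (h : HasSum (fun n => a (n + 1) * x ^ n) s) (h0 : a 0 = 0) :
    HasSum (fun n => a n * x ^ n) (x * s) := by
  rw [← hasSum_nat_add_iff' 1]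
  simp only [Finset.sum_range_one, h0, zero_mul, sub_zero]
  refine (h.mul_left x).congr_fun fun n => ?_
  ring

end PowerSeries

/-! ### The series `₂F₁(1/3, 2/3; 1/2; x)` and its integral -/

/-- The coefficients of `₂F₁(1/3, 2/3; 1/2; x)`. -/
noncomputable def trigCoeff (n : ℕ) : ℝ :=
  ∏ i ∈ Finset.range n, ((i : ℝ) + 1 / 3) * (i + 2 / 3) / ((i + 1 / 2) * (i + 1))

theorem trigCoeff_zero : trigCoeff 0 = 1 := by simp [trigCoeff]

theorem trigCoeff_succ (n : ℕ) : (n + 1) * (n + 1 / 2) * trigCoeff (n + 1) =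
    (n * (n + 1) + 2 / 9) * trigCoeff n := by
  rw [trigCoeff, Finset.prod_range_succ, ← trigCoeff]
  field_simp
  ring

theorem trigCoeff_nonneg (n : ℕ) : 0 ≤ trigCoeff n := Finset.prod_nonneg fun i _ => by positivity

theorem trigCoeff_le_one (n : ℕ) : trigCoeff n ≤ 1 := by
  refine Finset.prod_le_one (fun i _ => by positivity) fun i _ => ?_
  rw [div_le_one (by positivity)]
  nlinarith [(Nat.cast_nonneg i : (0 : ℝ) ≤ i)]

theorem abs_trigCoeff_le (n : ℕ) : |trigCoeff n| ≤ 1 * ((n : ℝ) + 1) ^ 0 := by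
  rw [abs_of_nonneg (trigCoeff_nonneg n)]
  simpa using trigCoeff_le_one n

theorem abs_trigCoeff_deriv_le (n : ℕ) :
    |((n : ℝ) + 1) * trigCoeff (n + 1)| ≤ 1 * ((n : ℝ) + 1) ^ 1 := by
  rw [abs_of_nonneg (mul_nonneg (by positivity) (trigCoeff_nonneg _))]
  have := trigCoeff_le_one (n + 1)
  have h0 := trigCoeff_nonneg (n + 1)
  nlinarith [(Nat.cast_nonneg n : (0 : ℝ) ≤ n)]

theorem abs_trigCoeff_deriv_deriv_le (n : ℕ) :
    |((n : ℝ) + 1) * (((n + 1 : ℕ) + 1) * trigCoeff (n + 1 + 1))| ≤ 2 * ((n : ℝ) + 1) ^ 2 := by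
  have hn := (Nat.cast_nonneg n : (0 : ℝ) ≤ n)
  rw [abs_of_nonneg (mul_nonneg (by positivity) (mul_nonneg (by positivity) (trigCoeff_nonneg _)))]
  have := trigCoeff_le_one (n + 1 + 1)
  calc ((n : ℝ) + 1) * (((n + 1 : ℕ) + 1) * trigCoeff (n + 1 + 1))
      ≤ ((n : ℝ) + 1) * (((n + 1 : ℕ) + 1) * 1) := by gcongr
    _ ≤ _ := by push_cast; nlinarith

/-- The function `₂F₁(1/3, 2/3; 1/2; x)`. -/
noncomputable def trigSeries (x : ℝ) : ℝ := ∑' n, trigCoeff n * x ^ n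

/-- The first derivative of `trigSeries`. -/
noncomputable def trigSeriesDeriv (x : ℝ) : ℝ := ∑' n : ℕ, ((n : ℝ) + 1) * trigCoeff (n + 1) * x ^ n

/-- The second derivative of `trigSeries`. -/
noncomputable def trigSeriesDerivDeriv (x : ℝ) : ℝ :=
  ∑' n : ℕ, ((n : ℝ) + 1) * (((n + 1 : ℕ) + 1) * trigCoeff (n + 1 + 1)) * x ^ n

theorem hasDerivAt_trigSeries {x : ℝ} (hx : |x| < 1) :
    HasDerivAt trigSeries (trigSeriesDeriv x) x :=
  hasDerivAt_tsum_mul_pow abs_trigCoeff_le hx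

theorem hasDerivAt_trigSeriesDeriv {x : ℝ} (hx : |x| < 1) :
    HasDerivAt trigSeriesDeriv (trigSeriesDerivDeriv x) x :=
  hasDerivAt_tsum_mul_pow abs_trigCoeff_deriv_le hx

/-- The hypergeometric differential equation. -/
theorem trigSeries_equation {x : ℝ} (hx : |x| < 1) :
    x * (1 - x) * trigSeriesDerivDeriv x + (1 / 2 - 2 * x) * trigSeriesDeriv x =
      2 / 9 * trigSeries x := by
  have h0 : HasSum (fun n => trigCoeff n * x ^ n) (trigSeries x) :=
    (summable_mul_pow_of_polynomial_bound abs_trigCoeff_le hx).hasSum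
  have h1 : HasSum (fun n : ℕ => ((n : ℝ) + 1) * trigCoeff (n + 1) * x ^ n) (trigSeriesDeriv x) :=
    (summable_mul_pow_of_polynomial_bound abs_trigCoeff_deriv_le hx).hasSum
  have h2 : HasSum (fun n : ℕ => ((n : ℝ) + 1) * (((n + 1 : ℕ) + 1) * trigCoeff (n + 1 + 1)) * x ^ n)
      (trigSeriesDerivDeriv x) :=
    (summable_mul_pow_of_polynomial_bound abs_trigCoeff_deriv_deriv_le hx).hasSum
  have h3 : HasSum (fun n : ℕ => (n : ℝ) * trigCoeff n * x ^ n) (x * trigSeriesDeriv x) :=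
    hasSum_mul_shift (a := fun n => (n : ℝ) * trigCoeff n) (by push_cast; exact h1) (by simp)
  have h4 : HasSum (fun n : ℕ => (n : ℝ) * (((n : ℝ) + 1) * trigCoeff (n + 1)) * x ^ n)
      (x * trigSeriesDerivDeriv x) :=
    hasSum_mul_shift (a := fun n => (n : ℝ) * (((n : ℝ) + 1) * trigCoeff (n + 1)))
      (by push_cast at h2 ⊢; exact h2) (by simp)
  have h5 : HasSum (fun n : ℕ => ((n : ℝ) - 1) * n * trigCoeff n * x ^ n)
      (x * (x * trigSeriesDerivDeriv x)) :=
    hasSum_mul_shift (a := fun n => ((n : ℝ) - 1) * n * trigCoeff n)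
      (h4.congr_fun fun n => by push_cast; ring) (by simp)
  -- The coefficient of `x ^ n` in the differential equation is the recurrence `trigCoeff_succ`.
  have h6 := ((h4.sub h5).add ((h1.mul_left (1 / 2)).sub (h3.mul_left 2))).sub (h0.mul_left (2 / 9))
  have h7 := h6.unique (hasSum_zero.congr_fun fun n => by
    linear_combination x ^ n * trigCoeff_succ n)
  linear_combination h7

/-- The trigonometric evaluation of `₂F₁(1/3, 2/3; 1/2; sin² φ)`. -/
theorem trigSeries_sin_sq {φ : ℝ} (hφ : φ ∈ Set.Ioo (-(Real.pi / 2)) (Real.pi / 2)) :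
    trigSeries (Real.sin φ ^ 2) * Real.cos φ = Real.cos (φ / 3) := by
  set I := Set.Ioo (-(Real.pi / 2)) (Real.pi / 2)
  have hsin : ∀ x ∈ I, |Real.sin x ^ 2| < 1 := by
    intro x hx
    rw [abs_of_nonneg (sq_nonneg _)]
    nlinarith [Real.sin_sq_add_cos_sq x, Real.cos_pos_of_mem_Ioo hx]
  -- The error `w` has derivative `v`, and the hypergeometric equation becomes `w'' = -w/9`.
  set w : ℝ → ℝ := fun x => trigSeries (Real.sin x ^ 2) * Real.cos x - Real.cos (x / 3) with hw
  set v : ℝ → ℝ := fun x => 2 * (trigSeriesDeriv (Real.sin x ^ 2) * (Real.sin x * Real.cos x ^ 2)) -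
    trigSeries (Real.sin x ^ 2) * Real.sin x + Real.sin (x / 3) / 3 with hv
  have hin : ∀ x, HasDerivAt (fun x => Real.sin x ^ 2) (2 * Real.sin x * Real.cos x) x := fun x => by
    simpa using (Real.hasDerivAt_sin x).fun_pow 2
  have hG : ∀ x ∈ I, HasDerivAt (fun x => trigSeries (Real.sin x ^ 2))
      (trigSeriesDeriv (Real.sin x ^ 2) * (2 * Real.sin x * Real.cos x)) x := fun x hx =>
    HasDerivAt.comp (h₂ := trigSeries) x (hasDerivAt_trigSeries (hsin x hx)) (hin x)
  have hG' : ∀ x ∈ I, HasDerivAt (fun x => trigSeriesDeriv (Real.sin x ^ 2))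
      (trigSeriesDerivDeriv (Real.sin x ^ 2) * (2 * Real.sin x * Real.cos x)) x := fun x hx =>
    HasDerivAt.comp (h₂ := trigSeriesDeriv) x (hasDerivAt_trigSeriesDeriv (hsin x hx)) (hin x)
  have h3 : ∀ x : ℝ, HasDerivAt (fun x : ℝ => x / 3) (1 / 3) x := fun x =>
    (hasDerivAt_id' x).div_const 3
  have hwd : ∀ x ∈ I, HasDerivAt w (v x) x := by
    intro x hx
    refine (((hG x hx).fun_mul (Real.hasDerivAt_cos x)).fun_sub (h3 x).cos).congr_deriv ?_
    simp only [hv]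
    ring
  have hvd : ∀ x ∈ I, HasDerivAt v (-(1 / 9) * w x) x := by
    intro x hx
    refine (((((hG' x hx).fun_mul ((Real.hasDerivAt_sin x).fun_mul
      ((Real.hasDerivAt_cos x).fun_pow 2))).const_mul 2).fun_sub
      ((hG x hx).fun_mul (Real.hasDerivAt_sin x))).fun_add ((h3 x).sin.div_const 3)).congr_deriv ?_
    have hode := trigSeries_equation (hsin x hx)
    have hc := Real.cos_sq' x
    simp only [hw]
    set s := Real.sin x
    set c := Real.cos x
    push_cast
    have e1 : s ^ 2 * (1 - s ^ 2) = s ^ 2 * c ^ 2 := by rw [hc]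
    rw [← hc] at hode
    linear_combination (4 * c) * hode +
      (2 * c * trigSeriesDeriv (s ^ 2)) * hc
  -- The energy `v² + w²/9` is constant and vanishes at `0`, which forces `w = 0`.
  have hE : ∀ x ∈ I, HasDerivAt (fun x => v x ^ 2 + w x ^ 2 / 9) 0 x := by
    intro x hx
    refine (((hvd x hx).fun_pow 2).fun_add (((hwd x hx).fun_pow 2).div_const 9)).congr_deriv ?_
    push_cast
    ring
  have h0 : (0 : ℝ) ∈ I := ⟨by linarith [Real.pi_pos], by linarith [Real.pi_pos]⟩
  have hconst := isOpen_Ioo.is_const_of_deriv_eq_zero isPreconnected_Ioo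
    (fun x hx => (hE x hx).differentiableAt.differentiableWithinAt)
    (fun x hx => (hE x hx).deriv) hφ h0
  have hz : trigSeries 0 = 1 := by
    rw [trigSeries, tsum_eq_single 0 (fun n hn => by simp [hn])]
    simp [trigCoeff_zero]
  have hw0 : w 0 = 0 := by simp [hw, hz]
  have hv0 : v 0 = 0 := by simp [hv]
  simp only [hw0, hv0] at hconst
  have : w φ = 0 := by nlinarith [sq_nonneg (v φ), sq_nonneg (w φ)]
  simp only [hw] at this
  linarith

/-- The Wallis product is `(1/2)ₙ / n!`, so it replaces the lower parameter `1/2` by `1`. -/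
theorem trigCoeff_mul_wallis (n : ℕ) :
    trigCoeff n * ∏ i ∈ Finset.range n, (2 * (i : ℝ) + 1) / (2 * i + 2) =
      ordinaryHypergeometricCoefficient (1 / 3 : ℝ) (2 / 3) 1 n := by
  rw [trigCoeff, ← Finset.prod_mul_distrib]
  induction n with
  | zero => simp [ordinaryHypergeometricCoefficient]
  | succ n ih =>
    rw [Finset.prod_range_succ, ih]
    simp only [ordinaryHypergeometricCoefficient, ascPochhammer_succ_eval, Nat.factorial_succ]
    have h1 : (ascPochhammer ℝ n).eval 1 ≠ 0 := (ascPochhammer_pos n 1 one_pos).ne'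
    have h2 : (n.factorial : ℝ) ≠ 0 := by exact_mod_cast n.factorial_ne_zero
    push_cast
    field_simp
    ring

/-- Integrate termwise, dominated by `trigCoeff n * κ ^ (2n)`; the mean of `cos ^ (2n)` over `[0,
π/2]` is the Wallis product. -/
theorem integral_trigSeries {κ : ℝ} (hκ0 : 0 < κ) (hκ1 : κ < 1) :
    ∫ θ in (0 : ℝ)..Real.pi / 2, trigSeries ((κ * Real.cos θ) ^ 2) =
      Real.pi / 2 * ordinaryHypergeometric (1 / 3 : ℝ) (2 / 3 : ℝ) (1 : ℝ) (κ ^ 2) := by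
  have hκ2 : |κ ^ 2| < 1 := by
    rw [abs_of_nonneg (sq_nonneg _)]; nlinarith
  have hlt : ∀ θ : ℝ, |(κ * Real.cos θ) ^ 2| < 1 := by
    intro θ
    rw [abs_of_nonneg (sq_nonneg _), mul_pow]
    nlinarith [Real.cos_sq_le_one θ, sq_nonneg κ, sq_nonneg (Real.cos θ)]
  have hsum := intervalIntegral.hasSum_integral_of_dominated_convergence
    (a := 0) (b := Real.pi / 2) (μ := MeasureTheory.volume)
    (F := fun (n : ℕ) (θ : ℝ) => trigCoeff n * ((κ * Real.cos θ) ^ 2) ^ n)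
    (f := fun θ => trigSeries ((κ * Real.cos θ) ^ 2))
    (fun n _ => trigCoeff n * (κ ^ 2) ^ n)
    (fun n => by fun_prop)
    (fun n => Eventually.of_forall fun θ _ => by
      have := trigCoeff_nonneg n
      rw [Real.norm_eq_abs, abs_of_nonneg (by positivity), mul_pow]
      gcongr
      nlinarith [Real.cos_sq_le_one θ, sq_nonneg κ])
    (Eventually.of_forall fun θ _ => summable_mul_pow_of_polynomial_bound abs_trigCoeff_le hκ2)
    intervalIntegrable_const
    (Eventually.of_forall fun θ _ =>
      (summable_mul_pow_of_polynomial_bound abs_trigCoeff_le (hlt θ)).hasSum)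
  rw [← hsum.tsum_eq, ordinaryHypergeometric_eq_tsum, ← tsum_mul_left]
  refine tsum_congr fun n => ?_
  have : ∀ θ : ℝ, trigCoeff n * ((κ * Real.cos θ) ^ 2) ^ n =
      trigCoeff n * (κ ^ 2) ^ n * Real.cos θ ^ (2 * n) := fun θ => by
    rw [mul_pow, mul_pow, pow_mul]; ring
  simp_rw [this]
  rw [intervalIntegral.integral_const_mul, EulerSine.integral_cos_pow_eq, integral_sin_pow_even,
    smul_eq_mul]
  have hw := trigCoeff_mul_wallis n
  rw [ordinaryHypergeometricCoefficient] at hw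
  rw [← hw]
  ring

/-! ### Substitution through the inverse of a decreasing function -/

/-- Integration by inverting a decreasing function: if `X` runs through the values of `f` and
`X' = -h * f'` at corresponding points, then `∫ h` is the length of the domain of `f`. -/
theorem integral_eq_of_strictAnti_substitution {f f' X X' h : ℝ → ℝ} {ω b : ℝ} (hω : 0 < ω)
    (hb : 0 < b) (hf : ∀ x ∈ Set.Ioc 0 ω, HasDerivAt f (f' x) x)
    (hneg : ∀ x ∈ Set.Ioo 0 ω, f' x < 0) (hlim : Tendsto f (𝓝[>] 0) atTop)
    (hX : ∀ θ ∈ Set.Ioo 0 b, HasDerivAt X (X' θ) θ) (hXgt : ∀ θ ∈ Set.Ioo 0 b, f ω < X θ)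
    (hX0 : Tendsto X (𝓝[>] 0) (𝓝 (f ω))) (hX1 : Tendsto X (𝓝[<] b) atTop)
    (hrel : ∀ θ ∈ Set.Ioo 0 b, ∀ x ∈ Set.Ioo 0 ω, f x = X θ → X' θ = -h θ * f' x)
    (hint : IntervalIntegrable h MeasureTheory.volume 0 b) :
    ∫ θ in (0 : ℝ)..b, h θ = ω := by
  have hc : ContinuousOn f (Set.Ioc 0 ω) := fun x hx => (hf x hx).continuousAt.continuousWithinAt
  have hanti : StrictAntiOn f (Set.Ioc 0 ω) := by
    refine strictAntiOn_of_deriv_neg (convex_Ioc 0 ω) hc fun x hx => ?_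
    rw [interior_Ioc] at hx
    rw [(hf x ⟨hx.1, hx.2.le⟩).deriv]
    exact hneg x hx
  have hsurj : ∀ x, f ω < x → ∃ u ∈ Set.Ioo 0 ω, f u = x := by
    intro x hx
    obtain ⟨δ, hδx, hδ⟩ := ((hlim.eventually_gt_atTop x).and (Ioo_mem_nhdsGT hω)).exists
    obtain ⟨u, hu, hux⟩ := intermediate_value_Ioo' hδ.2.le
      (hc.mono fun y hy => ⟨hδ.1.trans_le hy.1, hy.2⟩) ⟨hx, hδx⟩
    exact ⟨u, ⟨hδ.1.trans hu.1, hu.2⟩, hux⟩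
  choose! g hgmem hgf using hsurj
  have hlt : ∀ u ∈ Set.Ioo 0 ω, ∀ x, f ω < x → (g x < u ↔ f u < x) := fun u hu x hx => by
    conv_rhs => rw [← hgf x hx]
    exact (hanti.lt_iff_gt ⟨hu.1, hu.2.le⟩ ⟨(hgmem x hx).1, (hgmem x hx).2.le⟩).symm
  have hgt : ∀ u ∈ Set.Ioo 0 ω, ∀ x, f ω < x → (u < g x ↔ x < f u) := fun u hu x hx => by
    conv_rhs => rw [← hgf x hx]
    exact (hanti.lt_iff_gt ⟨(hgmem x hx).1, (hgmem x hx).2.le⟩ ⟨hu.1, hu.2.le⟩).symm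
  have hgc : ∀ x, f ω < x → ContinuousAt g x := by
    intro x hx
    refine tendsto_order.mpr ⟨fun a ha => ?_, fun a ha => ?_⟩
    · rcases le_or_gt a 0 with ha0 | ha0
      · filter_upwards [eventually_gt_nhds hx] with y hy using ha0.trans_lt (hgmem y hy).1
      · have hmem : a ∈ Set.Ioo 0 ω := ⟨ha0, ha.trans (hgmem x hx).2⟩
        filter_upwards [eventually_gt_nhds hx, eventually_lt_nhds ((hgt a hmem x hx).mp ha)]
          with y hy hya using (hgt a hmem y hy).mpr hya
    · rcases le_or_gt ω a with ha0 | ha0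
      · filter_upwards [eventually_gt_nhds hx] with y hy using (hgmem y hy).2.trans_le ha0
      · have hmem : a ∈ Set.Ioo 0 ω := ⟨(hgmem x hx).1.trans ha, ha0⟩
        filter_upwards [eventually_gt_nhds hx, eventually_gt_nhds ((hlt a hmem x hx).mp ha)]
          with y hy hya using (hlt a hmem y hy).mpr hya
  have hgd : ∀ x, f ω < x → HasDerivAt g (f' (g x))⁻¹ x := by
    intro x hx
    have hm := hgmem x hx
    refine HasDerivAt.of_local_left_inverse (hgc x hx) (hf _ ⟨hm.1, hm.2.le⟩) (hneg _ hm).ne ?_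
    filter_upwards [eventually_gt_nhds hx] with y hy using hgf y hy
  -- With `g` the inverse of `f` on `(f ω, ∞)`, the function `g ∘ X` falls from `ω` to `0` with
  -- derivative `-h`; the fundamental theorem of calculus concludes.
  have hT : ∀ θ ∈ Set.Ioo 0 b, HasDerivAt (fun θ => g (X θ)) (-h θ) θ := by
    intro θ hθ
    refine (HasDerivAt.comp (h₂ := g) θ (hgd _ (hXgt θ hθ)) (hX θ hθ)).congr_deriv ?_
    have hm := hgmem _ (hXgt θ hθ)
    rw [hrel θ hθ _ hm (hgf _ (hXgt θ hθ))]
    have := (hneg _ hm).ne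
    field_simp
  have hnear0 : ∀ᶠ θ in 𝓝[>] (0 : ℝ), θ ∈ Set.Ioo 0 b := Ioo_mem_nhdsGT hb
  have hnearb : ∀ᶠ θ in 𝓝[<] b, θ ∈ Set.Ioo 0 b := Ioo_mem_nhdsLT hb
  have hT0 : Tendsto (fun θ => g (X θ)) (𝓝[>] 0) (𝓝 ω) := by
    refine tendsto_order.mpr ⟨fun a ha => ?_, fun a ha => ?_⟩
    · rcases le_or_gt a 0 with ha0 | ha0
      · filter_upwards [hnear0] with θ hθ using ha0.trans_lt (hgmem _ (hXgt θ hθ)).1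
      · have hfa : f ω < f a := hanti ⟨ha0, ha.le⟩ ⟨hω, le_rfl⟩ ha
        filter_upwards [hnear0, hX0.eventually_lt_const hfa] with θ hθ h1
          using (hgt a ⟨ha0, ha⟩ _ (hXgt θ hθ)).mpr h1
    · filter_upwards [hnear0] with θ hθ using (hgmem _ (hXgt θ hθ)).2.trans ha
  have hTb : Tendsto (fun θ => g (X θ)) (𝓝[<] b) (𝓝 0) := by
    refine tendsto_order.mpr ⟨fun a ha => ?_, fun a ha => ?_⟩
    · filter_upwards [hnearb] with θ hθ using ha.trans (hgmem _ (hXgt θ hθ)).1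
    · rcases le_or_gt ω a with ha0 | ha0
      · filter_upwards [hnearb] with θ hθ using (hgmem _ (hXgt θ hθ)).2.trans_le ha0
      · filter_upwards [hnearb, hX1.eventually_gt_atTop (f a)] with θ hθ h1
          using (hlt a ⟨ha, ha0⟩ _ (hXgt θ hθ)).mpr h1
  have := intervalIntegral.integral_eq_sub_of_hasDerivAt_of_tendsto hb hT hint.neg hT0 hTb
  rw [intervalIntegral.integral_neg] at this
  linarith

/-! ### The cubic substitution -/

/-- The trigonometric parameter of the cubic substitution: `κ cos θ = sin φ`, `y = sin (φ / 3)`. -/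
noncomputable def cubicParam (κ θ : ℝ) : ℝ := Real.sin (Real.arcsin (κ * Real.cos θ) / 3)

/-- The value of `P_κ` with parameter `y`. -/
noncomputable def cubicValue (κ y : ℝ) : ℝ :=
  2 * κ ^ 2 / 3 * (y ^ 2)⁻¹ + (32 * y ^ 2 - 128 / 3 * y ^ 4 - 2)

/-- The derivative of `cubicValue`. -/
noncomputable def cubicValueDeriv (κ y : ℝ) : ℝ :=
  -(4 * κ ^ 2 / 3) * (y ^ 3)⁻¹ + 64 * y - 512 / 3 * y ^ 3

/-- The cubic polynomial `4 x³ - G₂ x - G₃` attached to `P_κ`. -/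
noncomputable def cubicPoly (κ x : ℝ) : ℝ :=
  4 * x ^ 3 - 48 * (1 + 8 * κ ^ 2) * x - 64 * (1 - 20 * κ ^ 2 - 8 * κ ^ 4)

theorem hasDerivAt_cubicValue (κ : ℝ) {y : ℝ} (hy : y ≠ 0) :
    HasDerivAt (cubicValue κ) (cubicValueDeriv κ y) y := by
  have h := ((((hasDerivAt_pow 2 y).fun_inv (pow_ne_zero 2 hy)).const_mul (2 * κ ^ 2 / 3)).fun_add
    ((((hasDerivAt_pow 2 y).const_mul 32).fun_sub
      ((hasDerivAt_pow 4 y).const_mul (128 / 3))).sub_const 2))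
  refine h.congr_deriv ?_
  rw [cubicValueDeriv]
  push_cast
  field_simp
  ring

/-- The cubic transformation behind the substitution. -/
theorem cubicValueDeriv_sq_mul (κ : ℝ) {y : ℝ} (hy : y ≠ 0) :
    cubicValueDeriv κ y ^ 2 * (κ ^ 2 - (3 * y - 4 * y ^ 3) ^ 2) =
      3 / 2 * cubicPoly κ (cubicValue κ y) := by
  rw [cubicValueDeriv, cubicPoly, cubicValue]
  field_simp
  ring

section Param
variable {κ θ : ℝ}

theorem kappa_mul_cos_mem (hκ0 : 0 < κ) (hκ1 : κ < 1) (θ : ℝ) :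
    κ * Real.cos θ ∈ Set.Ioo (-1 : ℝ) 1 := by
  rw [Set.mem_Ioo, ← abs_lt, abs_mul, abs_of_pos hκ0]
  nlinarith [Real.abs_cos_le_one θ, abs_nonneg (Real.cos θ)]

theorem continuous_cubicParam (κ : ℝ) : Continuous (cubicParam κ) := by
  unfold cubicParam
  fun_prop

theorem cubicParam_cubic (hκ0 : 0 < κ) (hκ1 : κ < 1) (θ : ℝ) :
    3 * cubicParam κ θ - 4 * cubicParam κ θ ^ 3 = κ * Real.cos θ := by
  have h := kappa_mul_cos_mem hκ0 hκ1 θ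
  rw [cubicParam, ← Real.sin_three_mul, mul_div_cancel₀ _ three_ne_zero,
    Real.sin_arcsin h.1.le h.2.le]

theorem arcsin_kappa_mem (hκ0 : 0 < κ) (hκ1 : κ < 1) (θ : ℝ) :
    Real.arcsin (κ * Real.cos θ) ∈ Set.Ioo (-(Real.pi / 2)) (Real.pi / 2) := by
  have h := kappa_mul_cos_mem hκ0 hκ1 θ
  exact ⟨Real.neg_pi_div_two_lt_arcsin.mpr h.1, Real.arcsin_lt_pi_div_two.mpr h.2⟩

/-- Since `0 < φ < π/2`, the angle `φ/3` stays below `π/6`. The endpoint `θ = π/2` is excluded: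
there `y = 0`, the pole of `cubicValue`. -/
theorem cubicParam_mem (hκ0 : 0 < κ) (hκ1 : κ < 1) (hθ : θ ∈ Set.Ico 0 (Real.pi / 2)) :
    cubicParam κ θ ∈ Set.Ioo (0 : ℝ) (1 / 2) := by
  have hpi := Real.pi_pos
  have hc : 0 < Real.cos θ := Real.cos_pos_of_mem_Ioo ⟨by linarith [hθ.1], hθ.2⟩
  have h1 : 0 < Real.arcsin (κ * Real.cos θ) := Real.arcsin_pos.mpr (mul_pos hκ0 hc)
  have h2 := (arcsin_kappa_mem hκ0 hκ1 θ).2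
  refine ⟨Real.sin_pos_of_pos_of_lt_pi (by linarith) (by linarith), ?_⟩
  rw [cubicParam, ← Real.sin_pi_div_six]
  exact Real.sin_lt_sin_of_lt_of_le_pi_div_two (by linarith) (by linarith) (by linarith)

/-- The chain rule produces `cos (φ/3) / cos φ`, which `trigSeries_sin_sq` identifies with the
series. -/
theorem hasDerivAt_cubicParam (hκ0 : 0 < κ) (hκ1 : κ < 1) (θ : ℝ) :
    HasDerivAt (cubicParam κ)
      (-(κ * Real.sin θ / 3 * trigSeries ((κ * Real.cos θ) ^ 2))) θ := by
  have h := kappa_mul_cos_mem hκ0 hκ1 θ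
  have hm := arcsin_kappa_mem hκ0 hκ1 θ
  have ht := trigSeries_sin_sq hm
  rw [Real.sin_arcsin h.1.le h.2.le, Real.cos_arcsin] at ht
  have hpos : 0 < √(1 - (κ * Real.cos θ) ^ 2) := by
    rw [← Real.cos_arcsin]
    exact Real.cos_pos_of_mem_Ioo hm
  have hd := ((HasDerivAt.comp (h₂ := Real.arcsin) θ (Real.hasDerivAt_arcsin h.1.ne' h.2.ne)
    ((Real.hasDerivAt_cos θ).const_mul κ)).div_const 3).sin
  refine hd.congr_deriv ?_
  simp only [Function.comp_apply]
  rw [← ht]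
  generalize √(1 - (κ * Real.cos θ) ^ 2) = r at hpos
  field_simp

/-- The sign is that of `48y⁴ - 128y⁶ - κ²`, and `(3y - 4y³)² - (48y⁴ - 128y⁶) = 9y²(1 - 4y²)²` is
positive. -/
theorem cubicValueDeriv_neg {y : ℝ} (hy : y ∈ Set.Ioo (0 : ℝ) (1 / 2))
    (hle : (3 * y - 4 * y ^ 3) ^ 2 ≤ κ ^ 2) : cubicValueDeriv κ y < 0 := by
  obtain ⟨h0, h1⟩ := hy
  have h2 : 0 < 1 - 4 * y ^ 2 := by nlinarith
  have h3 : 48 * y ^ 4 - 128 * y ^ 6 < κ ^ 2 := by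
    refine lt_of_lt_of_le ?_ hle
    have : 0 < y ^ 2 * (1 - 4 * y ^ 2) ^ 2 := by positivity
    nlinarith
  have : cubicValueDeriv κ y = -(4 / 3) * (κ ^ 2 - (48 * y ^ 4 - 128 * y ^ 6)) / y ^ 3 := by
    rw [cubicValueDeriv]
    field_simp
    ring
  rw [this]
  exact div_neg_of_neg_of_pos (by linarith) (by positivity)

theorem trigSeries_pos {x : ℝ} (hx0 : 0 ≤ x) (hx : |x| < 1) : 0 < trigSeries x := by
  have hs := summable_mul_pow_of_polynomial_bound abs_trigCoeff_le hx
  have h := hs.le_tsum 0 (fun n _ => mul_nonneg (trigCoeff_nonneg n) (pow_nonneg hx0 n))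
  rw [trigCoeff_zero, pow_zero, one_mul] at h
  exact one_pos.trans_le h

theorem abs_kappa_mul_cos_sq_lt_one (hκ0 : 0 < κ) (hκ1 : κ < 1) (θ : ℝ) :
    |(κ * Real.cos θ) ^ 2| < 1 := by
  have h := kappa_mul_cos_mem hκ0 hκ1 θ
  rw [abs_of_nonneg (sq_nonneg _), sq_lt_one_iff_abs_lt_one]
  exact abs_lt.mpr h

theorem cubicParam_cubic_sq_le (hκ0 : 0 < κ) (hκ1 : κ < 1) (θ : ℝ) :
    (3 * cubicParam κ θ - 4 * cubicParam κ θ ^ 3) ^ 2 ≤ κ ^ 2 := by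
  rw [cubicParam_cubic hκ0 hκ1, mul_pow]
  nlinarith [Real.cos_sq_le_one θ, sq_nonneg κ]

theorem cubicPoly_cubicValue (hκ0 : 0 < κ) (hκ1 : κ < 1) (hθ : θ ∈ Set.Ico 0 (Real.pi / 2)) :
    3 / 2 * cubicPoly κ (cubicValue κ (cubicParam κ θ)) =
      cubicValueDeriv κ (cubicParam κ θ) ^ 2 * (κ * Real.sin θ) ^ 2 := by
  rw [← cubicValueDeriv_sq_mul κ (cubicParam_mem hκ0 hκ1 hθ).1.ne', cubicParam_cubic hκ0 hκ1,
    mul_pow, mul_pow, Real.sin_sq]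
  ring

end Param

/-- A solution of `f' ^ 2 = 4 f ^ 3 - G₂ f - G₃` which decreases from `∞` at `0` to its minimum at
`ω`: the value of `ω`. -/
theorem eq_of_cubic_equation {κ : ℝ} (hκ0 : 0 < κ) (hκ1 : κ < 1) {f f' : ℝ → ℝ} {ω : ℝ}
    (hω : 0 < ω) (hf : ∀ x ∈ Set.Ioc 0 ω, HasDerivAt f (f' x) x)
    (hneg : ∀ x ∈ Set.Ioo 0 ω, f' x < 0) (hend : f' ω = 0) (hlim : Tendsto f (𝓝[>] 0) atTop)
    (hode : ∀ x ∈ Set.Ioc 0 ω, f' x ^ 2 = cubicPoly κ (f x)) :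
    ω = 1 / (2 * √6) * Real.pi *
      ordinaryHypergeometric (1 / 3 : ℝ) (2 / 3 : ℝ) (1 : ℝ) (κ ^ 2) := by
  have hpi := Real.pi_pos
  have hc : ContinuousOn f (Set.Ioc 0 ω) := fun x hx => (hf x hx).continuousAt.continuousWithinAt
  set X : ℝ → ℝ := fun θ => cubicValue κ (cubicParam κ θ) with hXdef
  set X' : ℝ → ℝ := fun θ => cubicValueDeriv κ (cubicParam κ θ) *
    (-(κ * Real.sin θ / 3 * trigSeries ((κ * Real.cos θ) ^ 2))) with hX'def
  have hX : ∀ θ ∈ Set.Ico 0 (Real.pi / 2), HasDerivAt X (X' θ) θ := fun θ hθ =>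
    HasDerivAt.comp (h₂ := cubicValue κ) θ
      (hasDerivAt_cubicValue κ (cubicParam_mem hκ0 hκ1 hθ).1.ne') (hasDerivAt_cubicParam hκ0 hκ1 θ)
  have htrig : ∀ θ, 0 < trigSeries ((κ * Real.cos θ) ^ 2) := fun θ =>
    trigSeries_pos (sq_nonneg _) (abs_kappa_mul_cos_sq_lt_one hκ0 hκ1 θ)
  have hDneg : ∀ θ ∈ Set.Ico 0 (Real.pi / 2), cubicValueDeriv κ (cubicParam κ θ) < 0 := fun θ hθ =>
    cubicValueDeriv_neg (cubicParam_mem hκ0 hκ1 hθ) (cubicParam_cubic_sq_le hκ0 hκ1 θ)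
  have hsin : ∀ θ ∈ Set.Ioo 0 (Real.pi / 2), 0 < Real.sin θ := fun θ hθ =>
    Real.sin_pos_of_pos_of_lt_pi hθ.1 (by linarith [hθ.2])
  have hX'pos : ∀ θ ∈ Set.Ioo 0 (Real.pi / 2), 0 < X' θ := fun θ hθ => by
    have h1 := hDneg θ ⟨hθ.1.le, hθ.2⟩
    have h2 := hsin θ hθ
    have h3 := htrig θ
    exact mul_pos_of_neg_of_neg h1 (neg_lt_zero.mpr (by positivity))
  have hXc : ContinuousOn X (Set.Ico 0 (Real.pi / 2)) :=
    fun θ hθ => (hX θ hθ).continuousAt.continuousWithinAt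
  have hXmono : StrictMonoOn X (Set.Ico 0 (Real.pi / 2)) := by
    refine strictMonoOn_of_deriv_pos (convex_Ico _ _) hXc fun θ hθ => ?_
    rw [interior_Ico] at hθ
    rw [(hX θ ⟨hθ.1.le, hθ.2⟩).deriv]
    exact hX'pos θ hθ
  have hQX : ∀ θ ∈ Set.Ioo 0 (Real.pi / 2), 0 < cubicPoly κ (X θ) := fun θ hθ => by
    have h1 := cubicPoly_cubicValue hκ0 hκ1 ⟨hθ.1.le, hθ.2⟩
    have h2 := (hDneg θ ⟨hθ.1.le, hθ.2⟩).ne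
    have h3 := hsin θ hθ
    have : 0 < cubicValueDeriv κ (cubicParam κ θ) ^ 2 * (κ * Real.sin θ) ^ 2 := by positivity
    change 0 < cubicPoly κ (cubicValue κ (cubicParam κ θ))
    linarith
  have h0mem : (0 : ℝ) ∈ Set.Ico 0 (Real.pi / 2) := ⟨le_rfl, by linarith⟩
  have hX1 : Tendsto X (𝓝[<] (Real.pi / 2)) atTop := by
    have hy : Tendsto (cubicParam κ) (𝓝[<] (Real.pi / 2)) (𝓝 0) := by
      have := ((continuous_cubicParam κ).tendsto (Real.pi / 2)).mono_left
        (nhdsWithin_le_nhds (s := Set.Iio (Real.pi / 2)))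
      simpa [cubicParam] using this
    have hy2 : Tendsto (fun θ => cubicParam κ θ ^ 2) (𝓝[<] (Real.pi / 2)) (𝓝[>] 0) := by
      refine tendsto_nhdsWithin_iff.mpr ⟨by simpa using hy.pow 2, ?_⟩
      filter_upwards [Ioo_mem_nhdsLT (show (0 : ℝ) < Real.pi / 2 by linarith)] with θ hθ
      exact pow_pos (cubicParam_mem hκ0 hκ1 ⟨hθ.1.le, hθ.2⟩).1 2
    have h1 := (tendsto_inv_nhdsGT_zero.comp hy2).const_mul_atTop
      (show 0 < 2 * κ ^ 2 / 3 by positivity)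
    have h2 := (((hy.pow 2).const_mul 32).sub ((hy.pow 4).const_mul (128 / 3))).sub_const 2
    exact h1.atTop_add h2
  have hQend : cubicPoly κ (f ω) = 0 := by
    rw [← hode ω ⟨hω, le_rfl⟩, hend]; ring
  -- Both are roots of the cubic. If `X 0` were larger, `f` would take that value inside `(0, ω)`,
  -- where `f' ≠ 0`; if `f ω` were larger, `X` would take it at an interior `θ`, where the cubic is
  -- positive.
  have hX0eq : X 0 = f ω := by
    apply le_antisymm
    · by_contra hlt
      rw [not_le] at hlt
      obtain ⟨δ, hδx, hδ⟩ := ((hlim.eventually_gt_atTop (X 0)).and (Ioo_mem_nhdsGT hω)).exists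
      obtain ⟨u, hu, hux⟩ := intermediate_value_Ioo' hδ.2.le
        (hc.mono fun y hy => ⟨hδ.1.trans_le hy.1, hy.2⟩) ⟨hlt, hδx⟩
      have hu' : u ∈ Set.Ioo 0 ω := ⟨hδ.1.trans hu.1, hu.2⟩
      have h1 := hode u ⟨hu'.1, hu'.2.le⟩
      have h2 := cubicPoly_cubicValue hκ0 hκ1 h0mem
      rw [Real.sin_zero, mul_zero, zero_pow two_ne_zero, mul_zero] at h2
      rw [hux] at h1
      have h3 : cubicPoly κ (X 0) = 0 := by
        change cubicPoly κ (cubicValue κ (cubicParam κ 0)) = 0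
        linarith
      rw [h3] at h1
      exact (hneg u hu').ne (pow_eq_zero_iff two_ne_zero |>.mp h1)
    · by_contra hlt
      rw [not_le] at hlt
      obtain ⟨δ, hδx, hδ⟩ := ((hX1.eventually_gt_atTop (f ω)).and
        (Ioo_mem_nhdsLT (show (0 : ℝ) < Real.pi / 2 by linarith))).exists
      obtain ⟨u, hu, hux⟩ := intermediate_value_Ioo hδ.1.le
        (hXc.mono fun y hy => ⟨hy.1, hy.2.trans_lt hδ.2⟩) ⟨hlt, hδx⟩
      have := hQX u ⟨hu.1, hu.2.trans hδ.2⟩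
      rw [hux, hQend] at this
      exact lt_irrefl _ this
  have hX0 : Tendsto X (𝓝[>] 0) (𝓝 (f ω)) := by
    rw [← hX0eq]
    exact (hX 0 h0mem).continuousAt.tendsto.mono_left nhdsWithin_le_nhds
  have hXgt : ∀ θ ∈ Set.Ioo 0 (Real.pi / 2), f ω < X θ := fun θ hθ => by
    rw [← hX0eq]
    exact hXmono h0mem ⟨hθ.1.le, hθ.2⟩ hθ.1
  have h6 := Real.sq_sqrt (show (0 : ℝ) ≤ 6 by norm_num)
  have h6p := Real.sqrt_pos.mpr (show (0 : ℝ) < 6 by norm_num)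
  have hcont : Continuous fun θ => 1 / √6 * trigSeries ((κ * Real.cos θ) ^ 2) := by
    refine continuous_const.mul (continuous_iff_continuousAt.mpr fun θ => ?_)
    exact ContinuousAt.comp (g := trigSeries) (hasDerivAt_trigSeries
      (abs_kappa_mul_cos_sq_lt_one hκ0 hκ1 θ)).continuousAt (by fun_prop)
  have key := integral_eq_of_strictAnti_substitution (f' := f') (X' := X')
    (h := fun θ => 1 / √6 * trigSeries ((κ * Real.cos θ) ^ 2)) hω
    (show 0 < Real.pi / 2 by linarith) hf hneg hlim (fun θ hθ => hX θ ⟨hθ.1.le, hθ.2⟩) hXgt hX0 hX1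
    (fun θ hθ x hx hxθ => by
      have h1 := hode x ⟨hx.1, hx.2.le⟩
      have h2 := cubicPoly_cubicValue hκ0 hκ1 ⟨hθ.1.le, hθ.2⟩
      rw [hxθ] at h1
      have h3 := htrig θ
      have h4 := hneg x hx
      have h5 := hX'pos θ hθ
      have h7 : 0 < -(1 / √6 * trigSeries ((κ * Real.cos θ) ^ 2)) * f' x :=
        mul_pos_of_neg_of_neg (neg_lt_zero.mpr (by positivity)) h4
      -- Both sides are positive, so squares suffice; the constant is `(1/3)² * (3/2) = 1/6`.
      rw [← sq_eq_sq₀ h5.le h7.le]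
      simp only [hX'def]
      have h8 : (1 / √6) ^ 2 = 1 / 6 := by rw [div_pow, h6, one_pow]
      have h9 : f' x ^ 2 = 2 / 3 * (cubicValueDeriv κ (cubicParam κ θ) ^ 2 *
          (κ * Real.sin θ) ^ 2) := by
        rw [h1, ← h2]; simp only [hXdef]; ring
      rw [mul_pow (-_) (f' x), neg_sq, mul_pow (1 / √6), h8, h9]
      ring)
    (hcont.intervalIntegrable _ _)
  rw [intervalIntegral.integral_const_mul, integral_trigSeries hκ0 hκ1] at key
  rw [← key]
  field_simp

/-! ### `℘` of a rectangular lattice on the real axis -/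

namespace PeriodPair
variable (L : PeriodPair)

/-- Complex conjugation on a lattice which is invariant under it. -/
noncomputable def conjEquiv (hL : ∀ z ∈ L.lattice, (starRingEnd ℂ) z ∈ L.lattice) :
    L.lattice ≃ L.lattice :=
  Function.Involutive.toPerm (fun l => ⟨(starRingEnd ℂ) l, hL l l.2⟩) fun l => by simp

theorem coe_conjEquiv (hL : ∀ z ∈ L.lattice, (starRingEnd ℂ) z ∈ L.lattice) (l : L.lattice) :
    (L.conjEquiv hL l : ℂ) = (starRingEnd ℂ) l := rfl

/-- Conjugation permutes the lattice, hence the terms of the series. This makes `℘` real on the real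
axis. -/
theorem weierstrassP_conj (hL : ∀ z ∈ L.lattice, (starRingEnd ℂ) z ∈ L.lattice) (z : ℂ) :
    L.weierstrassP ((starRingEnd ℂ) z) = (starRingEnd ℂ) (L.weierstrassP z) := by
  rw [weierstrassP, weierstrassP, Complex.conj_tsum, ← (L.conjEquiv hL).tsum_eq]
  refine tsum_congr fun l => ?_
  simp [coe_conjEquiv]

theorem derivWeierstrassP_conj (hL : ∀ z ∈ L.lattice, (starRingEnd ℂ) z ∈ L.lattice) (z : ℂ) :
    L.derivWeierstrassP ((starRingEnd ℂ) z) = (starRingEnd ℂ) (L.derivWeierstrassP z) := by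
  rw [derivWeierstrassP, derivWeierstrassP, map_neg, Complex.conj_tsum,
    ← (L.conjEquiv hL).tsum_eq]
  congr 1
  refine tsum_congr fun l => ?_
  simp [coe_conjEquiv, Complex.conj_ofNat]

theorem tendsto_re_weierstrassP :
    Tendsto (fun x : ℝ => (L.weierstrassP x).re) (𝓝[>] 0) atTop := by
  have h1 : Tendsto (fun x : ℝ => (x ^ 2)⁻¹) (𝓝[>] 0) atTop := by
    refine tendsto_inv_nhdsGT_zero.comp (tendsto_nhdsWithin_iff.mpr ⟨?_, ?_⟩)
    · have : Tendsto (fun x : ℝ => x ^ 2) (𝓝 0) (𝓝 (0 ^ 2)) := (continuous_pow 2).tendsto 0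
      rw [zero_pow two_ne_zero] at this
      exact this.mono_left nhdsWithin_le_nhds
    · filter_upwards [self_mem_nhdsWithin] with x hx using pow_pos (Set.mem_Ioi.mp hx) 2
  have h2 : ContinuousAt (fun x : ℝ => (L.weierstrassPExcept 0 x).re) 0 := by
    have h : ContinuousAt (L.weierstrassPExcept 0) ((0 : ℝ) : ℂ) := by
      simpa using (L.analyticAt_weierstrassPExcept 0).continuousAt
    exact Complex.continuous_re.continuousAt.comp (ContinuousAt.comp (f := fun x : ℝ => (x : ℂ)) h
      Complex.continuous_ofReal.continuousAt)
  refine (h1.atTop_add (h2.tendsto.mono_left nhdsWithin_le_nhds)).congr fun x => ?_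
  rw [L.weierstrassP_eq_inv_sq_add, Complex.add_re, ← Complex.ofReal_pow, ← Complex.ofReal_inv,
    Complex.ofReal_re]

section Rectangular
variable {a t : ℝ} {ha : 0 < a} {ht : 0 < t}

theorem mem_rectangular {z : ℂ} : z ∈ (rectangular a t ha ht).lattice ↔
    ∃ m n : ℤ, (m * a : ℂ) + n * (a * (t * Complex.I)) = z :=
  mem_lattice

theorem ofReal_mem_rectangular {x : ℝ} (hx : (x : ℂ) ∈ (rectangular a t ha ht).lattice) :
    ∃ m : ℤ, x = m * a := by
  obtain ⟨m, n, h⟩ := mem_rectangular.mp hx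
  refine ⟨m, ?_⟩
  simpa using (congrArg Complex.re h).symm

theorem ofReal_notMem_rectangular {x : ℝ} (h0 : 0 < x) (h1 : x < a) :
    (x : ℂ) ∉ (rectangular a t ha ht).lattice := by
  intro hx
  obtain ⟨m, rfl⟩ := ofReal_mem_rectangular hx
  have h2 : (0 : ℝ) < m := pos_of_mul_pos_left h0 ha.le
  have h3 : (m : ℝ) < 1 := by
    by_contra h
    nlinarith
  norm_cast at h2 h3
  lia

theorem conj_mem_rectangular (z : ℂ) (hz : z ∈ (rectangular a t ha ht).lattice) :
    (starRingEnd ℂ) z ∈ (rectangular a t ha ht).lattice := by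
  obtain ⟨m, n, rfl⟩ := mem_rectangular.mp hz
  exact mem_rectangular.mpr ⟨m, -n, by simp⟩

theorem rectangular_weierstrassP_ofReal (x : ℝ) : (rectangular a t ha ht).weierstrassP x =
    (((rectangular a t ha ht).weierstrassP x).re : ℂ) := by
  have := (rectangular a t ha ht).weierstrassP_conj conj_mem_rectangular x
  rw [Complex.conj_ofReal] at this
  exact (Complex.conj_eq_iff_re.mp this.symm).symm

theorem rectangular_derivWeierstrassP_ofReal (x : ℝ) :
    (rectangular a t ha ht).derivWeierstrassP x =
      (((rectangular a t ha ht).derivWeierstrassP x).re : ℂ) := by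
  have := (rectangular a t ha ht).derivWeierstrassP_conj conj_mem_rectangular x
  rw [Complex.conj_ofReal] at this
  exact (Complex.conj_eq_iff_re.mp this.symm).symm

theorem hasDerivAt_re_rectangular {x : ℝ} (h0 : 0 < x) (h1 : x < a) :
    HasDerivAt (fun x : ℝ => ((rectangular a t ha ht).weierstrassP x).re)
      ((rectangular a t ha ht).derivWeierstrassP x).re x :=
  ((rectangular a t ha ht).hasDerivAt_weierstrassP
    (ofReal_notMem_rectangular h0 h1)).real_of_complex

/-- Since `℘'` is odd with period `a`, its values at `a/2` and `-a/2` are both equal and opposite.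
-/
theorem re_derivWeierstrassP_half : ((rectangular a t ha ht).derivWeierstrassP (a / 2 : ℝ)).re = 0 := by
  have h1 := (rectangular a t ha ht).derivWeierstrassP_neg (a / 2 : ℝ)
  have h2 := (rectangular a t ha ht).derivWeierstrassP_add_coe (-(a / 2 : ℝ) : ℂ)
    ⟨(rectangular a t ha ht).ω₁, (rectangular a t ha ht).ω₁_mem_lattice⟩
  have h3 : (-(a / 2 : ℝ) : ℂ) + (rectangular a t ha ht).ω₁ = (a / 2 : ℝ) := by
    simp only [rectangular]; push_cast; ring
  rw [h3, h1] at h2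
  have h4 := congrArg Complex.re h2
  rw [Complex.neg_re] at h4
  linarith

/-- A zero of `℘'` in `(0, a/2)` would be a half-period, so the sign is constant; a positive sign
contradicts `℘ → ∞` at `0`. -/
theorem re_derivWeierstrassP_neg {x : ℝ} (hx : x ∈ Set.Ioo 0 (a / 2)) :
    ((rectangular a t ha ht).derivWeierstrassP x).re < 0 := by
  set f : ℝ → ℝ := fun x => ((rectangular a t ha ht).weierstrassP x).re
  set f' : ℝ → ℝ := fun x => ((rectangular a t ha ht).derivWeierstrassP x).re with hf'
  have hne : ∀ y ∈ Set.Ioo 0 (a / 2), f' y ≠ 0 := by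
    intro y hy h
    have h1 : (rectangular a t ha ht).derivWeierstrassP y = 0 := by
      rw [rectangular_derivWeierstrassP_ofReal]
      exact_mod_cast h
    have h2 := two_mul_mem_lattice_of_derivWeierstrassP_eq_zero _
      (ofReal_notMem_rectangular hy.1 (by linarith [hy.2])) h1
    exact ofReal_notMem_rectangular (a := a) (t := t) (ha := ha) (ht := ht) (x := 2 * y) (by linarith [hy.1]) (by linarith [hy.2])
      (by simpa using h2)
  have hc : ContinuousOn f' (Set.Ioo 0 (a / 2)) := fun y hy => by
    have h1 := ((rectangular a t ha ht).analyticOnNhd_derivWeierstrassP y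
      (ofReal_notMem_rectangular hy.1 (by linarith [hy.2]))).continuousAt
    exact (Complex.continuous_re.continuousAt.comp (ContinuousAt.comp (f := fun x : ℝ => (x : ℂ)) h1
      Complex.continuous_ofReal.continuousAt)).continuousWithinAt
  by_contra hge
  have hxpos : 0 < f' x := lt_of_le_of_ne (not_lt.mp hge) (hne x hx).symm
  have hpos : ∀ y ∈ Set.Ioo 0 (a / 2), 0 < f' y := by
    intro y hy
    by_contra hle
    obtain ⟨z, hz, hz0⟩ := isPreconnected_Ioo.intermediate_value hy hx hc
      ⟨not_lt.mp hle, hxpos.le⟩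
    exact hne z hz hz0
  have hmono : StrictMonoOn f (Set.Ioo 0 (a / 2)) := by
    refine strictMonoOn_of_deriv_pos (convex_Ioo _ _) (fun y hy =>
      (hasDerivAt_re_rectangular hy.1 (by linarith [hy.2])).continuousAt.continuousWithinAt)
      fun y hy => ?_
    rw [interior_Ioo] at hy
    rw [(hasDerivAt_re_rectangular hy.1 (by linarith [hy.2])).deriv]
    exact hpos y hy
  obtain ⟨δ, h1, h2⟩ := (((rectangular a t ha ht).tendsto_re_weierstrassP.eventually_gt_atTop
    (f x)).and (Ioo_mem_nhdsGT hx.1)).exists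
  exact absurd (hmono ⟨h2.1, h2.2.trans hx.2⟩ hx h2.2) (not_lt.mpr h1.le)

/-- The real half-period of the rectangular lattice with the invariants of `P_κ`. -/
theorem half_period_of_invariants {κ : ℝ} (hκ0 : 0 < κ) (hκ1 : κ < 1)
    (h2 : (rectangular a t ha ht).g₂ = ((48 * (1 + 8 * κ ^ 2) : ℝ) : ℂ))
    (h3 : (rectangular a t ha ht).g₃ = ((64 * (1 - 20 * κ ^ 2 - 8 * κ ^ 4) : ℝ) : ℂ)) :
    a / 2 = 1 / (2 * √6) * Real.pi *
      ordinaryHypergeometric (1 / 3 : ℝ) (2 / 3 : ℝ) (1 : ℝ) (κ ^ 2) := by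
  refine eq_of_cubic_equation hκ0 hκ1
    (f := fun x : ℝ => ((rectangular a t ha ht).weierstrassP x).re)
    (f' := fun x : ℝ => ((rectangular a t ha ht).derivWeierstrassP x).re) (by linarith)
    (fun x hx => hasDerivAt_re_rectangular hx.1 (by linarith [hx.2]))
    (fun x hx => re_derivWeierstrassP_neg hx) re_derivWeierstrassP_half
    (tendsto_re_weierstrassP _) fun x hx => ?_
  have h := derivWeierstrassP_sq _ (x : ℂ)
    (ofReal_notMem_rectangular (a := a) (t := t) (ha := ha) (ht := ht) hx.1 (by linarith [hx.2]))
  rw [rectangular_weierstrassP_ofReal, rectangular_derivWeierstrassP_ofReal, h2, h3] at h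
  rw [cubicPoly]
  exact_mod_cast h

end Rectangular
end PeriodPair

/-! ### Uniqueness of the real half-period and conclusion -/

/-- Two rectangular half-period pairs of a function have the same real half-period. -/
theorem IsRealFundamentalHalfPeriod.unique {P : ℂ → ℂ} {Ω₁ Ω₂ : ℝ}
    (h₁ : IsRealFundamentalHalfPeriod P Ω₁) (h₂ : IsRealFundamentalHalfPeriod P Ω₂) :
    Ω₁ = Ω₂ := by
  have key : ∀ {Ω₁ Ω₂ : ℝ}, IsRealFundamentalHalfPeriod P Ω₁ → IsRealFundamentalHalfPeriod P Ω₂ →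
      Ω₁ ≤ Ω₂ := by
    rintro A B ⟨A', ⟨-, hA⟩, ⟨hA', -⟩, hAP⟩ ⟨B', ⟨-, hB⟩, -, hBP⟩
    -- Expand the period `2B` in the other pair: real parts give `B = mA` with `m` a positive
    -- integer, so `A ≤ B`.
    obtain ⟨m, n, h⟩ := (hAP (2 * B)).mp ((hBP (2 * B)).mpr ⟨1, 0, by simp⟩)
    have h := congrArg Complex.re h
    simp [hA'] at h hA hB
    have hm : (0 : ℝ) < m := by
      by_contra hm
      nlinarith
    have hm1 : (1 : ℝ) ≤ m := by
      norm_cast at hm ⊢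
    nlinarith
  exact le_antisymm (key h₁ h₂) (key h₂ h₁)

theorem theoremO (κ : ℝ) (hκ0 : 0 < κ) (hκ1 : κ < 1) :
    (∃ P : ℂ → ℂ, IsPκ κ P) ∧
      ∀ P : ℂ → ℂ, IsPκ κ P → ∀ Ω : ℝ,
        IsRealFundamentalHalfPeriod P Ω ↔
          Ω = 1 / (2 * Real.sqrt 6) * Real.pi *
            ordinaryHypergeometric (1 / 3 : ℝ) (2 / 3 : ℝ) (1 : ℝ) (κ ^ 2) := by
  obtain ⟨a, t, ha, ht, h2, h3⟩ := PeriodPair.exists_rectangular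
    (g₂ := 48 * (1 + 8 * κ ^ 2)) (g₃ := 64 * (1 - 20 * κ ^ 2 - 8 * κ ^ 4)) (by
      have h : 0 < 1 - κ ^ 2 := by nlinarith
      have : 0 < κ ^ 2 * (1 - κ ^ 2) ^ 3 := by positivity
      -- The discriminant `G₂³ - 27 G₃²` equals `27 * 4096 * 64 * κ²(1 - κ²)³`.
      linear_combination (27 * 4096 * 64) * this)
  have hhalf := PeriodPair.half_period_of_invariants hκ0 hκ1 h2 h3
  push_cast at h2 h3
  refine ⟨⟨_, _, h2, h3, rfl⟩, ?_⟩
  rintro P ⟨L, hL2, hL3, rfl⟩ Ω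
  have hlat := PeriodPair.lattice_eq_of_invariants_eq (hL2.trans h2.symm) (hL3.trans h3.symm)
  have hreal : IsRealFundamentalHalfPeriod L.weierstrassP (a / 2) := by
    refine ⟨(a / 2 : ℝ) * (t * Complex.I), ⟨by simp, by simpa using ha⟩, ⟨by simp, ?_⟩, fun T => ?_⟩
    · simp; positivity
    rw [L.periodic_weierstrassP_iff, hlat, PeriodPair.mem_rectangular]
    refine exists_congr fun m => exists_congr fun n => ?_
    rw [eq_comm (a := T)]
    push_cast
    ring_nf
  rw [← hhalf]
  exact ⟨fun h => h.unique hreal, fun h => h ▸ hreal⟩
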